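/- Let $\mathbb K$ be a field of characteristic zero and let $\mathbf V$ be a symmetric tensor category over $\mathbb K$, i.e. an abelian $\mathbb K$-linear symmetric monoidal category with $\mathbb K$-bilinear tensor product. Let $\mathbf\Gamma$ be the opposite of the category of pointed finite sets $[n]=\{0,1,\dots,n\}$ (base point $0$), and let $E:\mathbf\Gamma\to\mathbf{Mon}(\mathbf V)$ be a symmetric cosimplicial monoid. It is regarded as a cosimplicial monoid through the functor $\mathbf\Delta\to\mathbf\Gamma$ given by Joyal duality followed by identification of the two end points of an interval. Let $\partial_i$ be the cofaces and $C^*(E)$ the cochain complex with differential $\partial=\sum_i(-1)^i\partial_i$ and cohomology $H^n(E)$. The group $S_n$ acts on $E(n)$; let $t_i$ be the action of the transposition $(i,i+1)$, and write $\hat a_i=t_i\cdots t_1\partial_0(a)\in E(n+1)$ for $a\in E(n)$. Let $P^n(E)\subset E(n)$ be the subobject of elements $a$ that are anti-symmetric ($\sigma(a)=\mathrm{sgn}(\sigma)a$ for $\sigma\in S_n$) and poly-primitive ($\partial_i(a)=\hat a_{i-1}+\hat a_i$ for $i=1,\dots,n$). The Hodge component $H^{n,i}(E)\subset H^n(E)$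 consists of the classes of the cocycles in the image of the Eulerian idempotent $e_n^{(i)}$, where $\sum_i e_n^{(i)}x^i=\sum_{\sigma\in S_n}\mathrm{sgn}(\sigma)\binom{x+n-1-\mathrm{des}(\sigma)}{n}\sigma$ and $\sigma$ acts on cochains through $\sigma^{-1}$. **(1)** For every $n\ge0$, $H^{n,n}(E)=P^n(E)$. Precisely: $P^n(E)$ consists of cocycles, the map $P^n(E)\to H^n(E)$ is a monomorphism, and its image is $H^{n,n}(E)$. Moreover $e_n^{(n)}$ induces a map $H^n(E)\to P^n(E)$ which is a left inverse of this monomorphism: the projection onto the top Hodge component. **(2)** Let $k\ge2$ and let $E$ be $k$-commutative: for all nondecreasing $\tau:[p]\to[l]$, $\pi:[q]\to[l]$ with linking number at most $k$, one has $E(\tau)(a)\,E(\pi)(b)=E(\pi)(b)\,E(\tau)(a)$. Here the linking number is the least $s+t-1$ such that the images can be decomposed into nonempty pieces $\mathrm{Im}\,\tau=A_1\cup\dots\cup A_s$, $\mathrm{Im}\,\pi=B_1\cup\dots\cup B_t$, $A_1<\dots<A_s$, $B_1<\dots<B_t$, with $A_1\le B_1\le A_2\le\cdots$ or $B_1\le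 A_1\le B_2\le\cdots$. Then for all $m,n$ with $m+n\ge k$ the top degree component of the bracket $\beta^{(k)}$, $$P^m(E)\otimes P^n(E)\xrightarrow{\ \beta^{(k)}\ }E(m+n-k)\xrightarrow{\ e^{(m+n-k)}_{m+n-k}\ }E(m+n-k),$$ is zero; the same holds with $\beta^{(k)}$ replaced by the Steenrod product $\cup_k$. Here, for $a\in E(p)$, $b\in E(q)$, $r=p+q-k$, $$a\cup_k b=\sum_\psi(-1)^{(p-1)(q-1)}\mathrm{sgn}(\psi)\,E(f_1)(a)\,E(f_2)(b)\in E(r),\qquad \beta^{(k)}(a\otimes b)=a\cup_kb-(-1)^{k+pq}\,b\cup_ka ,$$ where $\psi$ runs over the lattice paths with $r+1$ steps from $(0,0)$ to $(p+1,q+1)$ (each step being a possibly empty sequence of unit moves in the two directions) such that: the first unit move is in the first direction; the direction changes exactly $k+1$ times; each step has displacement $(1,0)$, $(0,1)$ or $(1,1)$; and no step $(1,0)$ is followed by a step $(0,1)$, nor $(0,1)$ by $(1,0)$. The maps $f_1:[p]\to[r]$, $f_2:[q]\to[r]$ send $j$ to the index of the step containing the $j$-th move in the first, respectively second, direction (counting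 from $0$), and $\mathrm{sgn}(\psi)$ is the sign of the $(p+1,q+1)$-shuffle given by the sequence of unit moves. -/

import Mathlib

open CategoryTheory CategoryTheory.Limits MonoidalCategory MonObj Opposite
open scoped Simplicial Polynomial

universe v u

/-! ### Pointed finite sets, Joyal duality and symmetric cosimplicial monoids -/

/-- The skeletal category of pointed finite sets: the object `⟨n⟩` is `{0, …, n}` with base
point `0`. -/
structure FinPtd where
  card : ℕ

namespace FinPtd

/-- Base point preserving maps `{0, …, a} → {0, …, b}`. -/
def Hom (a b : FinPtd) : Type := {f : Fin (a.card + 1) → Fin (b.card + 1) // f 0 = 0}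

instance : Category FinPtd where
  Hom := Hom
  id _ := ⟨id, rfl⟩
  comp f g := ⟨g.1 ∘ f.1, by simp [f.2, g.2]⟩

/-- The pointed bijection of `{0, …, n}` given by a permutation of the `n` points `1, …, n`
(the point `i + 1` corresponds to `i : Fin n`). -/
def ofPerm {n : ℕ} (s : Equiv.Perm (Fin n)) : (FinPtd.mk n) ⟶ (FinPtd.mk n) :=
  ⟨Fin.cases 0 (fun i => (s i).succ), rfl⟩

end FinPtd

/-- The Joyal dual of a nondecreasing map `t : [a] → [b]`, on objects: the interval map
`⟨b + 1⟩ → ⟨a + 1⟩` sending `i` to the number of `j` with `t j < i`.  On the generator `i → i + 1`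
its value is `min t⁻¹(i) → max t⁻¹(i) + 1` if `i` is in the image of `t`,
and an identity otherwise. -/
def joyalDual {a b : SimplexCategory} (t : a ⟶ b) (i : Fin (b.len + 2)) : Fin (a.len + 2) :=
  ⟨(Finset.univ.filter (fun j : Fin (a.len + 1) => (t.toOrderHom j : ℕ) < i)).card, by
    have := Finset.card_filter_le (Finset.univ : Finset (Fin (a.len + 1)))
      (fun j => (t.toOrderHom j : ℕ) < i)
    simp only [Finset.card_univ, Fintype.card_fin] at this
    omega⟩

theorem lt_joyalDual {a b : SimplexCategory} (t : a ⟶ b) (i : Fin (b.len + 2))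
    (j : Fin (a.len + 1)) : (j : ℕ) < joyalDual t i ↔ (t.toOrderHom j : ℕ) < i := by
  have hm : Monotone t.toOrderHom := t.toOrderHom.monotone
  constructor
  · intro h
    by_contra hc
    have hsub : Finset.univ.filter (fun l : Fin (a.len + 1) => (t.toOrderHom l : ℕ) < i)
        ⊆ Finset.Iio j := by
      intro l hl
      simp only [Finset.mem_filter, Finset.mem_univ, true_and, Finset.mem_Iio] at hl ⊢
      by_contra hlj
      have h1 : (t.toOrderHom j : ℕ) ≤ t.toOrderHom l := hm (not_lt.mp hlj)
      omega
    have h2 := Finset.card_le_card hsub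
    rw [Fin.card_Iio] at h2
    have h3 : (j : ℕ) < (Finset.univ.filter
      (fun l : Fin (a.len + 1) => (t.toOrderHom l : ℕ) < i)).card := h
    omega
  · intro h
    have hsub : Finset.Iic j ⊆
        Finset.univ.filter (fun l : Fin (a.len + 1) => (t.toOrderHom l : ℕ) < i) := by
      intro l hl
      simp only [Finset.mem_filter, Finset.mem_univ, true_and, Finset.mem_Iic] at hl ⊢
      have h1 : (t.toOrderHom l : ℕ) ≤ t.toOrderHom j := hm hl
      omega
    have h2 := Finset.card_le_card hsub
    rw [Fin.card_Iic] at h2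
    exact h2

theorem eq_joyalDual {a b : SimplexCategory} (t : a ⟶ b) (i : Fin (b.len + 2))
    (x : Fin (a.len + 2))
    (h : ∀ j : Fin (a.len + 1), (j : ℕ) < x ↔ (t.toOrderHom j : ℕ) < i) : joyalDual t i = x := by
  apply Fin.ext
  rcases lt_trichotomy (joyalDual t i : ℕ) x with hl | hl | hl
  · have hb := x.2
    have h1 := (h ⟨joyalDual t i, by omega⟩).1 hl
    have h2 := (lt_joyalDual t i ⟨joyalDual t i, by omega⟩).2 h1
    simp at h2
  · exact hl
  · have hb := (joyalDual t i).2
    have h1 := (lt_joyalDual t i ⟨x, by omega⟩).1 hl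
    have h2 := (h ⟨x, by omega⟩).2 h1
    simp at h2

theorem joyalDual_zero {a b : SimplexCategory} (t : a ⟶ b) : joyalDual t 0 = 0 :=
  eq_joyalDual t 0 0 (by simp)

theorem joyalDual_last {a b : SimplexCategory} (t : a ⟶ b) :
    joyalDual t (Fin.last _) = Fin.last _ :=
  eq_joyalDual t _ _ (by
    intro j
    have h1 := j.2
    have h2 := (t.toOrderHom j).2
    simp only [Fin.val_last]
    omega)

theorem joyalDual_id (a : SimplexCategory) (i : Fin (a.len + 2)) : joyalDual (𝟙 a) i = i :=
  eq_joyalDual _ _ _ (by simp)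

theorem joyalDual_comp {a b c : SimplexCategory} (t : a ⟶ b) (s : b ⟶ c) (i : Fin (c.len + 2)) :
    joyalDual (t ≫ s) i = joyalDual t (joyalDual s i) :=
  eq_joyalDual _ _ _ (by
    intro j
    rw [lt_joyalDual t (joyalDual s i) j, lt_joyalDual s i (t.toOrderHom j)]
    rfl)

/-- The identification of the two end points of `{0, …, n + 1}`, with values in the pointed set
`{0, …, n}`. -/
def glueEnds {n : ℕ} (x : Fin (n + 2)) : Fin (n + 1) :=
  if h : (x : ℕ) = n + 1 then 0 else ⟨x, by have := x.2; omega⟩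

theorem castSucc_glueEnds {n : ℕ} (x : Fin (n + 2)) (h : x ≠ Fin.last _) :
    (glueEnds x).castSucc = x := by
  have h' : ¬ (x : ℕ) = n + 1 := fun e => h (Fin.ext e)
  simp only [glueEnds, dif_neg h']
  rfl

theorem glueEnds_last (n : ℕ) : glueEnds (Fin.last (n + 1)) = 0 := by
  simp [glueEnds]

theorem glueEnds_castSucc {n : ℕ} (x : Fin (n + 1)) : glueEnds x.castSucc = x := by
  have h : ¬ (x : ℕ) = n + 1 := by have := x.2; omega
  simp [glueEnds, h]

/-- The functor from the simplex category to the opposite of pointed finite sets: Joyal duality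
followed by the functor from intervals to pointed sets which identifies the two end points. -/
def simplexToGamma : SimplexCategory ⥤ FinPtdᵒᵖ where
  obj a := op ⟨a.len⟩
  map {a b} t := Quiver.Hom.op
    (show FinPtd.mk b.len ⟶ FinPtd.mk a.len from
      ⟨fun i => glueEnds (joyalDual t i.castSucc), by
        change glueEnds (joyalDual t (0 : Fin (b.len + 1)).castSucc) = 0
        rw [Fin.castSucc_zero, joyalDual_zero]
        exact glueEnds_castSucc (n := a.len) 0⟩)
  map_id a := by
    apply Quiver.Hom.unop_inj
    apply Subtype.ext
    funext i
    change glueEnds (joyalDual (𝟙 a) i.castSucc) = i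
    rw [joyalDual_id, glueEnds_castSucc]
  map_comp {a b c} t s := by
    apply Quiver.Hom.unop_inj
    apply Subtype.ext
    funext i
    change glueEnds (joyalDual (t ≫ s) i.castSucc) =
      glueEnds (joyalDual t (glueEnds (joyalDual s i.castSucc)).castSucc)
    rw [joyalDual_comp]
    by_cases h : joyalDual s i.castSucc = Fin.last _
    · rw [h, glueEnds_last, joyalDual_last, glueEnds_last, Fin.castSucc_zero, joyalDual_zero]
      exact (glueEnds_castSucc (n := a.len) 0).symm
    · rw [castSucc_glueEnds _ h]

/-- A symmetric cosimplicial monoid in `V`: a functor from Segal's category `Γ` (the opposite of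
the category of pointed finite sets) to monoids in `V`. -/
abbrev SymmCosimplicialMonoid (V : Type u) [Category.{v} V] [MonoidalCategory V] :=
  FinPtdᵒᵖ ⥤ Mon V

/-! ### Linking numbers and `n`-commutativity -/

/-- Finite sets `A`, `B` of a linear order admit a shuffling of length `n`: there are decompositions
`A = A₁ ∪ … ∪ A_s`, `B = B₁ ∪ … ∪ B_t` into nonempty pieces with `A₁ < … < A_s`, `B₁ < … < B_t`,
`s + t = n + 1`, and `A₁ ≤ B₁ ≤ A₂ ≤ B₂ ≤ …` or `B₁ ≤ A₁ ≤ B₂ ≤ A₂ ≤ …`.  Here `C 0, …, C n` is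
the whole interlaced sequence of pieces. -/
def HasShuffling {N : ℕ} (A B : Set (Fin N)) (n : ℕ) : Prop :=
  ∃ C : Fin (n + 1) → Set (Fin N),
    (∀ i, (C i).Nonempty) ∧
    (∀ i j : Fin (n + 1), i < j → ∀ x ∈ C i, ∀ y ∈ C j, x ≤ y) ∧
    (∀ i j : Fin (n + 1), i < j → (i : ℕ) % 2 = (j : ℕ) % 2 → ∀ x ∈ C i, ∀ y ∈ C j, x < y) ∧
    ((A = {x | ∃ i : Fin (n + 1), (i : ℕ) % 2 = 0 ∧ x ∈ C i} ∧
      B = {x | ∃ i : Fin (n + 1), (i : ℕ) % 2 = 1 ∧ x ∈ C i}) ∨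
     (B = {x | ∃ i : Fin (n + 1), (i : ℕ) % 2 = 0 ∧ x ∈ C i} ∧
      A = {x | ∃ i : Fin (n + 1), (i : ℕ) % 2 = 1 ∧ x ∈ C i}))

/-- The linking number of two nondecreasing maps with the same target: the smallest length of a
shuffling of their images. -/
noncomputable def linkingNumber {a b c : SimplexCategory} (t : a ⟶ c) (s : b ⟶ c) : ℕ∞ :=
  ⨅ (n : ℕ) (_ : HasShuffling (Set.range t.toOrderHom) (Set.range s.toOrderHom) n), (n : ℕ∞)

/-- A cosimplicial monoid is `n`-commutative if the images of `E(t)` and `E(s)` commute for all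
pairs `t`, `s` of linking number at most `n`. -/
def IsNCommutative {V : Type u} [Category.{v} V] [MonoidalCategory V] [BraidedCategory V]
    (F : CosimplicialObject (Mon V)) (n : ℕ) : Prop :=
  ∀ (a b c : SimplexCategory) (t : a ⟶ c) (s : b ⟶ c), linkingNumber t s ≤ n →
    ((F.map t).hom ⊗ₘ (F.map s).hom) ≫ μ[(F.obj c).X] =
      (β_ (F.obj a).X (F.obj b).X).hom ≫ ((F.map s).hom ⊗ₘ (F.map t).hom) ≫ μ[(F.obj c).X]

/-! ### Lattice paths -/

/-- A lattice path `⟨m + 1⟩ → ⟨p + 1⟩ □ ⟨q + 1⟩` from `(0, 0)` to `(p + 1, q + 1)`.  The funny tensor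
product of the two free categories is free on the rectangular grid, so its morphisms are words
in unit moves, `0` being a move in the first direction and `1` a move in the second one; `step i`
is the image of the generator `i → i + 1`. -/
structure LatticePath (m p q : ℕ) where
  step : Fin (m + 1) → List (Fin 2)
  count_zero : ∑ i, (step i).count 0 = p + 1
  count_one : ∑ i, (step i).count 1 = q + 1

namespace LatticePath

variable {m p q : ℕ}

theorem step_injective : Function.Injective (step : LatticePath m p q → _) := by
  rintro ⟨_, _, _⟩ ⟨_, _, _⟩ h
  cases h
  rfl

theorem length_step_le (w : LatticePath m p q) (i : Fin (m + 1)) :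
    (w.step i).length ≤ p + q + 2 := by
  have h0 : (w.step i).count 0 ≤ p + 1 := by
    rw [← w.count_zero]
    exact Finset.single_le_sum (f := fun i => (w.step i).count 0) (fun _ _ => Nat.zero_le _)
      (Finset.mem_univ i)
  have h1 : (w.step i).count 1 ≤ q + 1 := by
    rw [← w.count_one]
    exact Finset.single_le_sum (f := fun i => (w.step i).count 1) (fun _ _ => Nat.zero_le _)
      (Finset.mem_univ i)
  have h2 : ∀ l : List (Fin 2), l.length = l.count 0 + l.count 1 := by
    intro l
    induction l with
    | nil => rfl
    | cons x l ih => fin_cases x <;> simp [ih] <;> omega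
  rw [h2]
  omega

instance : Finite (LatticePath m p q) := by
  have : Finite {l : List (Fin 2) // l.length ≤ p + q + 2} :=
    (List.finite_length_le (Fin 2) (p + q + 2)).to_subtype
  exact Finite.of_injective
    (fun w : LatticePath m p q => fun i =>
      (⟨w.step i, w.length_step_le i⟩ : {l : List (Fin 2) // l.length ≤ p + q + 2}))
    (fun w w' h => step_injective (funext fun i => congrArg Subtype.val (congrFun h i)))

noncomputable instance : Fintype (LatticePath m p q) := Fintype.ofFinite _

/-- The sequence of all unit moves of the path. -/
def word (w : LatticePath m p q) : List (Fin 2) := (List.ofFn w.step).flatten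

/-- The complexity: the number of changes of direction. -/
def complexity (w : LatticePath m p q) : ℕ :=
  ((w.word.zip w.word.tail).filter (fun x => x.1 ≠ x.2)).length

/-- The path is even if it starts by a move in the first direction. -/
def IsEven (w : LatticePath m p q) : Prop := w.word.head? = some 0

/-- The displacement in direction `c` of the `i`-th step; this is the image of the lattice path in
the commutative lattice `⟨p + 1⟩ × ⟨q + 1⟩`. -/
def move (w : LatticePath m p q) (c : Fin 2) (i : Fin (m + 1)) : ℕ := (w.step i).count c

/-- The image of the path in the commutative lattice is a smooth path: every step is one of
`(1,0)`, `(0,1)`, `(1,1)`, and there are neither low corners (`(1,0)` followed by `(0,1)`) nor upper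
corners (`(0,1)` followed by `(1,0)`). -/
def IsSmooth (w : LatticePath m p q) : Prop :=
  (∀ i, w.move 0 i ≤ 1 ∧ w.move 1 i ≤ 1 ∧ 1 ≤ w.move 0 i + w.move 1 i) ∧
  ∀ i j : Fin (m + 1), (i : ℕ) + 1 = j →
    ¬ (w.move 0 i = 1 ∧ w.move 1 i = 0 ∧ w.move 0 j = 0 ∧ w.move 1 j = 1) ∧
    ¬ (w.move 0 i = 0 ∧ w.move 1 i = 1 ∧ w.move 0 j = 1 ∧ w.move 1 j = 0)

/-- The shuffle of `{0, …, p + q + 1}` given by the sequence of unit moves: the `i`-th move goes to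
`j` if it is the `j`-th move in the first direction, and to `j + (p + 1)` if it is the `j`-th move
in the second direction (everything counted from `0`). -/
def shuffle (w : LatticePath m p q) (i : Fin w.word.length) : ℕ :=
  (w.word.take i).count (w.word.get i) + if w.word.get i = 0 then 0 else p + 1

/-- The sign of the path: the sign of its shuffle permutation, by counting inversions. -/
def sign (w : LatticePath m p q) : ℤ :=
  (-1) ^ (Finset.univ.filter (fun x : Fin w.word.length × Fin w.word.length =>
    x.1 < x.2 ∧ w.shuffle x.2 < w.shuffle x.1)).card

theorem dual_aux {N : ℕ} (f : Fin (m + 1) → ℕ) (hf : ∑ i, f i = N + 1) (j : Fin (N + 1)) :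
    (Finset.univ.filter (fun i : Fin (m + 1) => ∑ l ∈ Finset.Iic i, f l ≤ j)).card < m + 1 := by
  have h : Finset.univ.filter (fun i : Fin (m + 1) => ∑ l ∈ Finset.Iic i, f l ≤ j)
      ⊂ Finset.univ := by
    rw [Finset.ssubset_univ_iff]
    intro h
    have h1 : Fin.last m ∈ Finset.univ.filter
      (fun i : Fin (m + 1) => ∑ l ∈ Finset.Iic i, f l ≤ j) := by rw [h]; exact Finset.mem_univ _
    have h2 : Finset.Iic (Fin.last m) = Finset.univ := by
      ext x
      simp [Fin.le_last]
    rw [Finset.mem_filter, h2, hf] at h1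
    have := j.2
    omega
  simpa using Finset.card_lt_card h

/-- The Joyal dual `[N] → [m]` of the interval map `⟨m + 1⟩ → ⟨N + 1⟩` with increments `f`: it sends
`j` to the index of the step which passes over the generator `j → j + 1`, that is to the number of
steps which end at a point `≤ j`. -/
def dual {N : ℕ} (f : Fin (m + 1) → ℕ) (hf : ∑ i, f i = N + 1) : ⦋N⦌ ⟶ ⦋m⦌ :=
  SimplexCategory.mkHom
    { toFun := fun j => ⟨_, dual_aux f hf j⟩
      monotone' := fun j j' h => by
        have hs : Finset.univ.filter (fun i : Fin (m + 1) => ∑ l ∈ Finset.Iic i, f l ≤ j) ⊆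
            Finset.univ.filter (fun i : Fin (m + 1) => ∑ l ∈ Finset.Iic i, f l ≤ j') := by
          intro i hi
          simp only [Finset.mem_filter, Finset.mem_univ, true_and] at hi ⊢
          exact hi.trans h
        exact Finset.card_le_card hs }

/-- The Joyal dual of the first projection of the path. -/
def dualFst (w : LatticePath m p q) : ⦋p⦌ ⟶ ⦋m⦌ := dual (w.move 0) w.count_zero

/-- The Joyal dual of the second projection of the path. -/
def dualSnd (w : LatticePath m p q) : ⦋q⦌ ⟶ ⦋m⦌ := dual (w.move 1) w.count_one

end LatticePath

/-! ### Steenrod products and brackets -/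

section Bracket

variable {V : Type u} [Category.{v} V] [Preadditive V] [MonoidalCategory V]

open Classical in
/-- The Steenrod product `∪ᵢ : E(p) ⊗ E(q) ⟶ E(m)` (meant for `m = p + q - i`): the signed sum over
even smooth lattice paths of complexity `i + 1` of the operations
`a ⊗ b ↦ E(f₁)(a) · E(f₂)(b)`, where `f₁`, `f₂` are the Joyal duals of the projections of the path.
The sign `(-1)^((p+1)(q+1))` is `(-1)^((p-1)(q-1))`. -/
noncomputable def steenrod (F : CosimplicialObject (Mon V)) (i p q m : ℕ) :
    (F.obj ⦋p⦌).X ⊗ (F.obj ⦋q⦌).X ⟶ (F.obj ⦋m⦌).X :=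
  ∑ w : LatticePath m p q,
    if w.IsSmooth ∧ w.complexity = i + 1 ∧ w.IsEven then
      ((-1) ^ ((p + 1) * (q + 1)) * w.sign) •
        (((F.map w.dualFst).hom ⊗ₘ (F.map w.dualSnd).hom) ≫ μ[(F.obj ⦋m⦌).X])
    else 0

/-- The bracket `β⁽ᵏ⁾ : E(p) ⊗ E(q) ⟶ E(m)` (meant for `m = p + q - k`),
`a ⊗ b ↦ a ∪ₖ b - (-1)^(k + pq) b ∪ₖ a`. -/
noncomputable def bracket [BraidedCategory V] (F : CosimplicialObject (Mon V)) (k p q m : ℕ) :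
    (F.obj ⦋p⦌).X ⊗ (F.obj ⦋q⦌).X ⟶ (F.obj ⦋m⦌).X :=
  steenrod F k p q m -
    ((-1 : ℤ) ^ (k + p * q)) •
      ((β_ (F.obj ⦋p⦌).X (F.obj ⦋q⦌).X).hom ≫ steenrod F k q p m)

end Bracket

namespace SymmCosimplicialMonoid

section Monoidal

variable {V : Type u} [Category.{v} V] [MonoidalCategory V] (E : SymmCosimplicialMonoid V)

/-- The underlying cosimplicial monoid. -/
def cosimplicial : CosimplicialObject (Mon V) := simplexToGamma ⋙ E

/-- The underlying cosimplicial object of `V`. -/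
def cosimplicialObj : CosimplicialObject V := E.cosimplicial ⋙ Mon.forget V

/-- The component `E(n)`. -/
abbrev comp (n : ℕ) : V := E.cosimplicialObj.obj ⦋n⦌

/-- The left action of the symmetric group on `E(n)`: by functoriality a permutation acts
contravariantly, so `s` acts by the map induced by `s⁻¹`. -/
def act (n : ℕ) (s : Equiv.Perm (Fin n)) : E.comp n ⟶ E.comp n :=
  (E.map (FinPtd.ofPerm s⁻¹).op).hom

/-- The action of the transposition of two neighbours on `E(n + 1)`. -/
def actSwap (n : ℕ) (i : Fin n) : E.comp (n + 1) ⟶ E.comp (n + 1) :=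
  E.act (n + 1) (Equiv.swap i.castSucc i.succ)

/-- The map `a ↦ âᵢ = tᵢ ⋯ t₁ ∂₀(a)`, where `t_{j+1}` is `actSwap n j`. -/
def hat (n : ℕ) (i : Fin (n + 1)) : E.comp n ⟶ E.comp (n + 1) :=
  Fin.induction (motive := fun _ => E.comp n ⟶ E.comp (n + 1)) (E.cosimplicialObj.δ 0)
    (fun j f => f ≫ E.actSwap n j) i

end Monoidal

section Abelian

variable {V : Type u} [Category.{v} V] [Abelian V] [MonoidalCategory V]
  (E : SymmCosimplicialMonoid V)

/-- The cochain complex of `E`, with differential `∑ (-1)^i ∂ᵢ`. -/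
noncomputable def complex : CochainComplex V ℕ :=
  (AlgebraicTopology.alternatingCofaceMapComplex V).obj E.cosimplicialObj

/-- The map `S ⟶ H^n(E)` sending a cocycle to its class, for a subobject `S` of `E(n)` which
consists of cocycles. -/
noncomputable def classMap {n : ℕ} (S : Subobject (E.comp n))
    (h : S.arrow ≫ E.complex.d n (n + 1) = 0) : (S : V) ⟶ E.complex.homology n :=
  E.complex.liftCycles (i := n) S.arrow (n + 1) (by simp) h ≫ E.complex.homologyπ n

/-- The subobject of `E(n)` of anti-symmetric elements: `s(a) = sgn(s) a` for all `s`. -/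
noncomputable def antisymmetric (n : ℕ) : Subobject (E.comp n) :=
  Finset.univ.inf fun s : Equiv.Perm (Fin n) =>
    kernelSubobject (E.act n s - (Equiv.Perm.sign s : ℤ) • 𝟙 (E.comp n))

/-- The subobject of `E(n)` of poly-primitive elements: `∂ᵢ(a) = â_{i-1} + âᵢ` for
`i = 1, …, n`. -/
noncomputable def polyPrimitive (n : ℕ) : Subobject (E.comp n) :=
  Finset.univ.inf fun i : Fin n =>
    kernelSubobject (E.cosimplicialObj.δ i.succ.castSucc - (E.hat n i.castSucc + E.hat n i.succ))

/-- The subobject `Pⁿ(E)` of anti-symmetric poly-primitive elements. -/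
noncomputable def P (n : ℕ) : Subobject (E.comp n) := E.antisymmetric n ⊓ E.polyPrimitive n

/-- The number of descents of a permutation. -/
def descents {n : ℕ} (s : Equiv.Perm (Fin n)) : ℕ :=
  (Finset.univ.filter (fun x : Fin n × Fin n => (x.1 : ℕ) + 1 = x.2 ∧ s x.2 < s x.1)).card

/-- The polynomial `binom(x + n - 1 - d, n)` in `x`. -/
noncomputable def eulerianPoly (𝕜 : Type*) [Field 𝕜] (n d : ℕ) : 𝕜[X] :=
  Polynomial.C ((n.factorial : 𝕜)⁻¹) *
    ∏ j ∈ Finset.range n, (Polynomial.X + Polynomial.C ((j : 𝕜) - (d : 𝕜)))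

variable (𝕜 : Type*) [Field 𝕜] [Linear 𝕜 V]

/-- The action on `E(n)` of the Eulerian idempotent `eₙ⁽ⁱ⁾`, where
`∑ᵢ eₙ⁽ⁱ⁾ xⁱ = ∑ₛ sgn(s) binom(x + n - 1 - des(s), n) s`.  The permutation `s` of the slots of a chain
acts on cochains by `s⁻¹`. -/
noncomputable def eulerian (n i : ℕ) : E.comp n ⟶ E.comp n :=
  ∑ s : Equiv.Perm (Fin n),
    (((Equiv.Perm.sign s : ℤ) : 𝕜) * (eulerianPoly 𝕜 n (descents s)).coeff i) • E.act n s⁻¹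

/-- The image of the Eulerian idempotent `eₙ⁽ⁱ⁾`. -/
noncomputable def eulerianImage (n i : ℕ) : Subobject (E.comp n) :=
  imageSubobject (E.eulerian 𝕜 n i)

/-- The Hodge component `H^{n,i}(E)` as a subobject of the cohomology `H^n(E)`: the classes
of the cocycles in the image of the Eulerian idempotent `eₙ⁽ⁱ⁾`. -/
noncomputable def hodgeComponent (n i : ℕ) : Subobject (E.complex.homology n) :=
  imageSubobject
    (((Subobject.pullback (E.complex.iCycles n)).obj (eulerianImage E 𝕜 n i)).arrow ≫
      E.complex.homologyπ n)

end Abelian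

end SymmCosimplicialMonoid

/-! ### Pointed maps -/

/-! Everything is read off from pointed maps. In `E` the inner cofaces are induced by the maps
`merge i`, which identify two neighbouring points, the outer ones by `drop 0` and `drop (Fin.last
n)`, and `hat n i` is induced by `drop i` (`face_interior`, `face_zero`, `face_last`,
`hat_eq_pull`). Poly-primitivity thus says that an element is additive in each slot.

Top Hodge component. The coefficient of `x ^ n` in the Eulerian polynomial is `1 / n!` whatever the
number of descents, so the top idempotent is anti-symmetrization (`eulerian_self`). It kills
coboundaries: after a signed sum over all permutations the inner cofaces cancel in pairs and the two
outer ones cancel each other (`sum_signedSum_face`). Restricting the same sum to permutations with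
`s p < s (p + 1)` leaves exactly the defect of poly-primitivity at `p` of the anti-symmetrized
element, so anti-symmetrized cocycles are poly-primitive (`sum_signedSum_lt_face`,
`isPolyPrimitive_comp_altSum`). Conversely the differential of a poly-primitive element telescopes
to zero (`IsPolyPrimitive.comp_diff`). Anti-symmetrization therefore maps cohomology to `P n` and is
the identity on `P n`.

Vanishing. By additivity, the image of a poly-primitive element under any pointed map is a sum of
images under maps whose fibres over non-base points are singletons
(`IsPolyPrimitive.comp_pull_mem`). For two such maps out of `r` points, with `r + 2 ≤ p + q`, the
selected sets share two points. Exchanging these changes the sign of both factors, hence fixes their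
product, whereas the top idempotent changes sign (`tensor_pull_comp_mul_comp_eulerian`). This
applies to each term of the Steenrod product separately. -/

theorem val_predAbove {n : ℕ} (p : Fin n) (x : Fin (n + 1)) :
    (p.predAbove x : ℕ) = if (p : ℕ) < x then (x : ℕ) - 1 else x := by
  simp only [Fin.predAbove, Fin.lt_def, Fin.val_castSucc]
  split_ifs <;> simp

theorem val_succAbove {n : ℕ} (p : Fin (n + 1)) (x : Fin n) :
    (p.succAbove x : ℕ) = if (x : ℕ) < p then (x : ℕ) else x + 1 := by
  simp only [Fin.succAbove, Fin.lt_def, Fin.val_castSucc]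
  split_ifs <;> simp

theorem val_glueEnds {n : ℕ} (x : Fin (n + 2)) :
    (glueEnds x : ℕ) = if (x : ℕ) = n + 1 then 0 else (x : ℕ) := by
  unfold glueEnds
  split_ifs <;> simp_all

namespace FinPtd

theorem fin_ext {p : ℕ} {a b : Fin (p + 1)} (h : ∀ j : Fin p, a = j.succ ↔ b = j.succ) :
    a = b := by
  rcases Fin.eq_zero_or_eq_succ a with rfl | ⟨j, rfl⟩
  · rcases Fin.eq_zero_or_eq_succ b with rfl | ⟨j, rfl⟩
    · rfl
    · exact (h j).2 rfl
  · exact ((h j).1 rfl).symm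

theorem hom_ext {a b : ℕ} {f g : FinPtd.mk b ⟶ FinPtd.mk a}
    (h : ∀ v : Fin b, f.1 v.succ = g.1 v.succ) : f = g := by
  apply Subtype.ext
  funext x
  refine Fin.cases ?_ h x
  exact f.2.trans g.2.symm

/-- A pointed map given by its values on the points other than the base point. -/
def ofFun {a b : ℕ} (f : Fin b → Fin (a + 1)) : FinPtd.mk b ⟶ FinPtd.mk a :=
  ⟨Fin.cases 0 f, rfl⟩

@[simp] theorem ofFun_succ {a b : ℕ} (f : Fin b → Fin (a + 1)) (v : Fin b) :
    (ofFun f).1 v.succ = f v := rfl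

@[simp] theorem ofPerm_succ {n : ℕ} (s : Equiv.Perm (Fin n)) (v : Fin n) :
    (ofPerm s).1 v.succ = (s v).succ := rfl

@[simp] theorem map_zero {a b : ℕ} (f : FinPtd.mk b ⟶ FinPtd.mk a) : f.1 0 = 0 := f.2

@[simp] theorem comp_apply {a b c : ℕ} (f : FinPtd.mk a ⟶ FinPtd.mk b)
    (g : FinPtd.mk b ⟶ FinPtd.mk c) (x : Fin (a + 1)) : (f ≫ g).1 x = g.1 (f.1 x) := rfl

/-- The pointed map which sends the points `p` and `p + 1` to the same point. -/
def merge {n : ℕ} (p : Fin n) : FinPtd.mk (n + 1) ⟶ FinPtd.mk n :=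
  ofFun fun x => (p.predAbove x).succ

/-- The pointed map which sends `p` to the base point and is bijective otherwise. -/
def drop {n : ℕ} (p : Fin (n + 1)) : FinPtd.mk (n + 1) ⟶ FinPtd.mk n :=
  ofFun (p.insertNth (α := fun _ => Fin (n + 1)) 0 Fin.succ)

@[simp] theorem merge_succ {n : ℕ} (p : Fin n) (x : Fin (n + 1)) :
    (merge p).1 x.succ = (p.predAbove x).succ := rfl

@[simp] theorem drop_same {n : ℕ} (p : Fin (n + 1)) : (drop p).1 p.succ = 0 := by
  simp [drop]

@[simp] theorem drop_succAbove {n : ℕ} (p : Fin (n + 1)) (j : Fin n) :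
    (drop p).1 (p.succAbove j).succ = j.succ := by
  simp [drop]

theorem ofPerm_comp {n : ℕ} (s t : Equiv.Perm (Fin n)) :
    ofPerm s ≫ ofPerm t = ofPerm (t * s) := hom_ext fun _ => rfl

theorem ofPerm_one (n : ℕ) : ofPerm (1 : Equiv.Perm (Fin n)) = 𝟙 (FinPtd.mk n) :=
  hom_ext fun _ => rfl

theorem ofPerm_swap_comp_merge {n : ℕ} (i : Fin n) :
    ofPerm (Equiv.swap i.castSucc i.succ) ≫ merge i = merge i := by
  refine hom_ext fun x => ?_
  rw [comp_apply, ofPerm_succ, merge_succ, merge_succ, Equiv.swap_apply_def]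
  split_ifs with h1 h2
  · subst h1; simp
  · subst h2; simp
  · rfl

theorem ofPerm_comp_drop {n : ℕ} (p i : Fin (n + 1)) (s : Equiv.Perm (Fin (n + 1)))
    (t : Equiv.Perm (Fin n)) (h1 : s p = i) (h2 : ∀ j, s (p.succAbove j) = i.succAbove (t j)) :
    ofPerm s ≫ drop i = drop p ≫ ofPerm t := by
  refine hom_ext fun x => ?_
  rcases Fin.eq_self_or_eq_succAbove p x with rfl | ⟨j, rfl⟩
  · simp [h1]
  · simp [h2]

/-- Off the point `i.castSucc`, `merge i` inverts `i.castSucc.succAbove`; the removed point is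
governed by `h3`. -/
theorem ofPerm_comp_merge {n : ℕ} (p i : Fin n) (s : Equiv.Perm (Fin (n + 1)))
    (t : Equiv.Perm (Fin n)) (h1 : s p.castSucc = i.castSucc)
    (h2 : ∀ j, s (p.castSucc.succAbove j) = i.castSucc.succAbove (t j)) (h3 : t p = i) :
    ofPerm s ≫ merge i = merge p ≫ ofPerm t := by
  refine hom_ext fun x => ?_
  rcases Fin.eq_self_or_eq_succAbove p.castSucc x with rfl | ⟨j, rfl⟩
  · simp [h1, h3]
  · simp [h2]

theorem ofPerm_cycleRange_comp_drop {n : ℕ} (p : Fin (n + 1)) :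
    ofPerm p.cycleRange ≫ drop 0 = drop p := by
  rw [ofPerm_comp_drop p 0 p.cycleRange 1 (by simp) (by simp), ofPerm_one, Category.comp_id]

/-! ### Cofaces as pointed maps -/

/-- The pointed map which induces the `i`-th coface. -/
def face {n : ℕ} (i : Fin (n + 2)) : FinPtd.mk (n + 1) ⟶ FinPtd.mk n :=
  (simplexToGamma.map (SimplexCategory.δ (n := n) i)).unop

theorem joyalDual_δ {n : ℕ} (i : Fin (n + 2)) (y : Fin (n + 3)) :
    joyalDual (SimplexCategory.δ (n := n) i) y = (i.predAbove y : Fin (n + 2)) := by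
  refine eq_joyalDual _ _ _ fun j => ?_
  change (j : ℕ) < ((i.predAbove y : Fin (n + 2)) : ℕ) ↔ (i.succAbove j : ℕ) < y
  rw [val_predAbove, val_succAbove]
  split_ifs <;> omega

theorem face_apply {n : ℕ} (i : Fin (n + 2)) (y : Fin (n + 2)) :
    (face i).1 y = glueEnds (i.predAbove y.castSucc) :=
  congrArg glueEnds (joyalDual_δ i y.castSucc)

theorem face_interior {n : ℕ} (i : Fin n) : face i.succ.castSucc = merge i := by
  refine hom_ext fun x => Fin.ext ?_
  rw [face_apply, merge_succ, val_glueEnds, val_predAbove, Fin.val_succ, val_predAbove]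
  have h1 := i.2
  have h2 := x.2
  simp only [Fin.val_castSucc, Fin.val_succ]
  split_ifs <;> omega

theorem face_zero {n : ℕ} : face (0 : Fin (n + 2)) = drop 0 := by
  refine hom_ext fun x => Fin.ext ?_
  rw [face_apply, val_glueEnds, val_predAbove]
  rcases Fin.eq_self_or_eq_succAbove 0 x with rfl | ⟨j, rfl⟩
  · rw [drop_same]; simp
  · rw [drop_succAbove]
    have h2 := j.2
    simp
    omega

theorem face_last {n : ℕ} : face (Fin.last (n + 1)) = drop (Fin.last n) := by
  refine hom_ext fun x => Fin.ext ?_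
  rw [face_apply, val_glueEnds, val_predAbove]
  rcases Fin.eq_self_or_eq_succAbove (Fin.last n) x with rfl | ⟨j, rfl⟩
  · rw [drop_same]; simp
  · rw [drop_succAbove]
    have h2 := j.2
    simp only [Fin.val_last, Fin.val_castSucc, Fin.val_succ, val_succAbove]
    split_ifs <;> omega

end FinPtd

/-! ### Signed sums over permutations -/

/-- The permutation which sends `p` to `i` and is `t` on the complements of these points. -/
def insertPerm {n : ℕ} (p i : Fin (n + 1)) (t : Equiv.Perm (Fin n)) : Equiv.Perm (Fin (n + 1)) :=
  i.cycleRange⁻¹ * Equiv.Perm.decomposeFin.symm (0, t) * p.cycleRange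

@[simp] theorem insertPerm_same {n : ℕ} (p i : Fin (n + 1)) (t : Equiv.Perm (Fin n)) :
    insertPerm p i t p = i := by
  simp [insertPerm, Equiv.Perm.inv_def]

@[simp] theorem insertPerm_succAbove {n : ℕ} (p i : Fin (n + 1)) (t : Equiv.Perm (Fin n))
    (j : Fin n) : insertPerm p i t (p.succAbove j) = i.succAbove (t j) := by
  simp [insertPerm, Equiv.Perm.inv_def]

/-- The cycles moving `p` and `i` to the front have signs `(-1) ^ p` and `(-1) ^ i`. -/
theorem sign_insertPerm {n : ℕ} (p i : Fin (n + 1)) (t : Equiv.Perm (Fin n)) :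
    (Equiv.Perm.sign (insertPerm p i t) : ℤ) =
      (-1) ^ ((p : ℕ) + (i : ℕ)) * Equiv.Perm.sign t := by
  simp [insertPerm, pow_add]
  ring

theorem insertPerm_bijective {n : ℕ} (p : Fin (n + 1)) :
    Function.Bijective (fun x : Fin (n + 1) × Equiv.Perm (Fin n) => insertPerm p x.1 x.2) := by
  rw [Fintype.bijective_iff_injective_and_card]
  constructor
  · rintro ⟨i, t⟩ ⟨i', t'⟩ h
    have h1 : i = i' := by simpa using congrArg (fun s => s p) h
    subst h1
    refine Prod.ext rfl (Equiv.ext fun j => ?_)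
    simpa using congrArg (fun s => s (p.succAbove j)) h
  · simp [Fintype.card_perm, Nat.factorial_succ]

theorem sum_perm_succ {G : Type*} [AddCommGroup G] {n : ℕ} (p : Fin (n + 1))
    (F : Equiv.Perm (Fin (n + 1)) → G) :
    ∑ s, F s = ∑ i, ∑ t, F (insertPerm p i t) := by
  rw [← (insertPerm_bijective p).sum_comp, Fintype.sum_prod_type]

section SignedSum

open FinPtd

variable {G : Type*} [AddCommGroup G] {n : ℕ} (Φ : (FinPtd.mk (n + 1) ⟶ FinPtd.mk n) → G)

/-- The weighted signed sum of the values of `Φ` at the reorderings of `f`. -/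
def signedSum (c : Equiv.Perm (Fin (n + 1)) → ℤ) (f : FinPtd.mk (n + 1) ⟶ FinPtd.mk n) : G :=
  ∑ s, (c s * Equiv.Perm.sign s) • Φ (ofPerm s ≫ f)

theorem signedSum_add (c c' : Equiv.Perm (Fin (n + 1)) → ℤ) (f) :
    signedSum Φ (fun s => c s + c' s) f = signedSum Φ c f + signedSum Φ c' f := by
  simp [signedSum, add_mul, add_smul, Finset.sum_add_distrib]

/-- `merge i` does not see the exchange of the two points it identifies, so `s` and its product with
that transposition contribute opposite terms. -/
theorem signedSum_merge_eq_zero (c : Equiv.Perm (Fin (n + 1)) → ℤ) (i : Fin n)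
    (hc : ∀ s, c (Equiv.swap i.castSucc i.succ * s) = c s) :
    signedSum Φ c (merge i) = 0 := by
  have hne : i.castSucc ≠ i.succ := Fin.castSucc_lt_succ.ne
  refine Finset.sum_involution (fun s _ => Equiv.swap i.castSucc i.succ * s) ?_ ?_ ?_ ?_
  · intro s _
    rw [← ofPerm_comp, Category.assoc, ofPerm_swap_comp_merge, hc, Equiv.Perm.sign_mul,
      Equiv.Perm.sign_swap hne, ← add_smul]
    simp
  · intro s _ _ h
    have := congrArg Equiv.Perm.sign h
    rw [Equiv.Perm.sign_mul, Equiv.Perm.sign_swap hne] at this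
    rcases Int.units_eq_one_or (Equiv.Perm.sign s) with h | h <;> rw [h] at this <;>
      exact absurd this (by decide)
  · simp
  · intro s _
    simp

/-- Dropping the last point is a cycle of sign `(-1) ^ n` followed by dropping the first; the sum is
reindexed along this cycle. -/
theorem signedSum_drop_last (c : Equiv.Perm (Fin (n + 1)) → ℤ) :
    signedSum Φ c (drop (Fin.last n)) =
      (-1 : ℤ) ^ n • signedSum Φ (fun s => c ((Fin.last n).cycleRange⁻¹ * s)) (drop 0) := by
  rw [signedSum, signedSum, Finset.smul_sum]
  symm
  rw [← Equiv.sum_comp (Equiv.mulLeft (Fin.last n).cycleRange)]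
  refine Finset.sum_congr rfl fun s _ => ?_
  simp only [Equiv.coe_mulLeft, Equiv.Perm.sign_mul, Fin.sign_cycleRange, smul_smul]
  have h : ofPerm s ≫ drop (Fin.last n) = ofPerm ((Fin.last n).cycleRange * s) ≫ drop 0 := by
    rw [← ofPerm_comp, Category.assoc, ofPerm_cycleRange_comp_drop]
  rw [h, inv_mul_cancel_left]
  congr 1
  push_cast
  have : ((-1 : ℤ) ^ n) * (-1) ^ n = 1 := by rw [← mul_pow]; simp
  linear_combination ((c s * (Equiv.Perm.sign s : ℤ))) * this

theorem signedSum_drop_zero (p : Fin (n + 1)) :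
    signedSum Φ (fun s => if s p = 0 then 1 else 0) (drop 0) =
      (-1 : ℤ) ^ (p : ℕ) • ∑ t, (Equiv.Perm.sign t : ℤ) • Φ (drop p ≫ ofPerm t) := by
  rw [signedSum, sum_perm_succ p, Finset.sum_eq_single 0, Finset.smul_sum]
  · refine Finset.sum_congr rfl fun t _ => ?_
    rw [ofPerm_comp_drop p 0 _ t (by simp) (by simp), sign_insertPerm]
    simp [smul_smul]
  · intro i _ hi
    simp [hi]
  · simp

theorem signedSum_merge_single (p i : Fin n) :
    signedSum Φ (fun s => if s p.castSucc = i.castSucc ∧ s p.succ = i.succ then 1 else 0)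
      (merge i) = (-1 : ℤ) ^ ((p : ℕ) + (i : ℕ)) • ∑ t, (if t p = i then 1 else 0 : ℤ) •
        (Equiv.Perm.sign t : ℤ) • Φ (merge p ≫ ofPerm t) := by
  rw [signedSum, sum_perm_succ p.castSucc, Finset.sum_eq_single i.castSucc, Finset.smul_sum]
  · refine Finset.sum_congr rfl fun t _ => ?_
    have h1 : insertPerm p.castSucc i.castSucc t p.succ = i.succ ↔ t p = i := by
      rw [← Fin.succAbove_castSucc_self p, insertPerm_succAbove, ← Fin.succAbove_castSucc_self i,
        Fin.succAbove_right_inj]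
    by_cases h : t p = i
    · rw [ofPerm_comp_merge p i _ t (by simp) (by simp) h, sign_insertPerm]
      simp [h1, h, smul_smul]
    · simp [h1, h]
  · intro j _ hj
    simp [hj]
  · simp

theorem sum_face (Ψ : (FinPtd.mk (n + 1) ⟶ FinPtd.mk n) → G) :
    ∑ i : Fin (n + 2), (-1 : ℤ) ^ (i : ℕ) • Ψ (face i) =
      Ψ (drop 0) - ∑ i : Fin n, (-1 : ℤ) ^ (i : ℕ) • Ψ (merge i) -
        (-1 : ℤ) ^ n • Ψ (drop (Fin.last n)) := by
  rw [Fin.sum_univ_succ, Fin.sum_univ_castSucc]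
  simp only [Fin.succ_last, face_last, face_zero, Fin.succ_castSucc, face_interior]
  simp [pow_succ, Finset.sum_neg_distrib]
  abel

/-- Weight one is invariant under all reindexings: the inner faces vanish, and the two outer ones
agree up to the sign that cancels them. -/
theorem sum_signedSum_face :
    ∑ i : Fin (n + 2), (-1 : ℤ) ^ (i : ℕ) • signedSum Φ (fun _ => 1) (face i) = 0 := by
  rw [sum_face, signedSum_drop_last, smul_smul, ← mul_pow]
  simp [signedSum_merge_eq_zero]

/-- Exchanging the neighbours `i`, `i + 1` affects the order of two distinct numbers only if they
are these two; the subtracted indicator makes both sides zero in that case. -/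
theorem ite_lt_sub_ite_swap (i : Fin n) (x y : Fin (n + 1)) (h : x ≠ y) :
    ((if Equiv.swap i.castSucc i.succ x < Equiv.swap i.castSucc i.succ y then 1 else 0) -
      (if Equiv.swap i.castSucc i.succ x = i.castSucc ∧ Equiv.swap i.castSucc i.succ y = i.succ
        then 1 else 0) : ℤ) =
    (if x < y then 1 else 0) - (if x = i.castSucc ∧ y = i.succ then 1 else 0) := by
  have hx : (Equiv.swap i.castSucc i.succ x : ℕ) =
      if (x : ℕ) = i then (i : ℕ) + 1 else if (x : ℕ) = i + 1 then (i : ℕ) else x := by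
    rw [Equiv.swap_apply_def]
    simp only [Fin.ext_iff, Fin.val_castSucc, Fin.val_succ]
    split_ifs <;> simp
  have hy : (Equiv.swap i.castSucc i.succ y : ℕ) =
      if (y : ℕ) = i then (i : ℕ) + 1 else if (y : ℕ) = i + 1 then (i : ℕ) else y := by
    rw [Equiv.swap_apply_def]
    simp only [Fin.ext_iff, Fin.val_castSucc, Fin.val_succ]
    split_ifs <;> simp
  have hxy : (x : ℕ) ≠ y := fun e => h (Fin.ext e)
  simp only [Fin.ext_iff, Fin.lt_def, hx, hy, Fin.val_castSucc, Fin.val_succ]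
  split_ifs <;> omega

/-- The half sum breaks the symmetry just enough. Inner faces still cancel, except for the
permutations placing `p`, `p + 1` at `i`, `i + 1`, which yield `merge p`; the outer faces differ by
the permutations placing `p` or `p + 1` first, which yield the two `drop` terms. -/
theorem sum_signedSum_lt_face (p : Fin n) :
    ∑ i : Fin (n + 2), (-1 : ℤ) ^ (i : ℕ) •
        signedSum Φ (fun s => if s p.castSucc < s p.succ then 1 else 0) (face i) =
      (-1 : ℤ) ^ (p : ℕ) • ∑ t : Equiv.Perm (Fin n), (Equiv.Perm.sign t : ℤ) •
        (Φ (drop p.castSucc ≫ ofPerm t) + Φ (drop p.succ ≫ ofPerm t) -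
          Φ (merge p ≫ ofPerm t)) := by
  set w : Equiv.Perm (Fin (n + 1)) → ℤ := fun s => if s p.castSucc < s p.succ then 1 else 0
    with hw
  have hmerge : ∀ i : Fin n, signedSum Φ w (merge i) =
      (-1 : ℤ) ^ ((p : ℕ) + (i : ℕ)) • ∑ t, (if t p = i then 1 else 0 : ℤ) •
        (Equiv.Perm.sign t : ℤ) • Φ (merge p ≫ ofPerm t) := by
    intro i
    rw [← signedSum_merge_single, ← sub_eq_zero]
    -- With the exceptional permutations removed, the weight is invariant under the transposition,
    -- so its signed sum vanishes.
    let c := fun s : Equiv.Perm (Fin (n + 1)) =>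
      w s - if s p.castSucc = i.castSucc ∧ s p.succ = i.succ then 1 else 0
    have h := signedSum_add Φ c
      (fun s => if s p.castSucc = i.castSucc ∧ s p.succ = i.succ then 1 else 0) (merge i)
    simp only [c, sub_add_cancel] at h
    rw [h, add_sub_cancel_right]
    apply signedSum_merge_eq_zero
    intro s
    have hne : s p.castSucc ≠ s p.succ := fun e => Fin.castSucc_lt_succ.ne (s.injective e)
    simp only [hw, Equiv.Perm.mul_apply]
    exact ite_lt_sub_ite_swap i _ _ hne
  have hends : signedSum Φ w (drop 0) - (-1 : ℤ) ^ n • signedSum Φ w (drop (Fin.last n)) =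
      signedSum Φ (fun s => if s p.castSucc = 0 then 1 else 0) (drop 0) -
      signedSum Φ (fun s => if s p.succ = 0 then 1 else 0) (drop 0) := by
    rw [signedSum_drop_last, smul_smul, ← mul_pow, sub_eq_sub_iff_add_eq_add]
    simp only [mul_neg, _root_.mul_one, neg_neg, one_pow, one_smul]
    rw [← signedSum_add, ← signedSum_add]
    congr 1
    funext s
    have hne : s p.castSucc ≠ s p.succ := fun e => Fin.castSucc_lt_succ.ne (s.injective e)
    simp only [hw, Equiv.Perm.mul_apply]
    -- The inverse cycle moves `0` to the end and lowers the rest by one, so it alters a comparison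
    -- only when one of the two values is `0`.
    have key : ∀ x : Fin (n + 1), ((Fin.last n).cycleRange⁻¹ x : ℕ) =
        if x = 0 then n else (x : ℕ) - 1 := by
      intro x
      refine Fin.cases ?_ (fun j => ?_) x
      · simp [Equiv.Perm.inv_def]
      · rw [Equiv.Perm.inv_def, Fin.cycleRange_symm_succ]
        simp
    simp only [Fin.lt_def, key]
    generalize s p.castSucc = x at hne ⊢
    generalize s p.succ = y at hne ⊢
    have hx := x.2
    have hy := y.2
    simp only [Fin.ext_iff, ne_eq, Fin.val_zero] at *
    split_ifs <;> omega
  rw [sum_face, sub_right_comm, hends, signedSum_drop_zero, signedSum_drop_zero]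
  -- Each `t` satisfies `t p = i` for exactly one `i`, so summing over `i` removes the condition.
  have hsum : ∑ i : Fin n, (-1 : ℤ) ^ (i : ℕ) • signedSum Φ w (merge i) =
      (-1 : ℤ) ^ (p : ℕ) • ∑ t, (Equiv.Perm.sign t : ℤ) • Φ (merge p ≫ ofPerm t) := by
    simp only [hmerge, smul_smul, ← pow_add]
    have : ∀ i : ℕ, (-1 : ℤ) ^ (i + (p + i)) = (-1) ^ (p : ℕ) := by
      intro i
      rw [show i + ((p : ℕ) + i) = p + 2 * i by ring, pow_add]
      simp
    simp only [this, ← Finset.smul_sum]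
    rw [Finset.sum_comm]
    simp
  rw [hsum]
  simp only [smul_sub, smul_add, Finset.sum_sub_distrib, Finset.sum_add_distrib, Fin.val_succ,
    Fin.val_castSucc, pow_succ, mul_neg, _root_.mul_one, neg_smul]
  abel

end SignedSum

/-! ### Anti-symmetrization and poly-primitive cocycles -/

namespace SymmCosimplicialMonoid

open FinPtd

section Pull

variable {V : Type u} [Category.{v} V] [MonoidalCategory V] (E : SymmCosimplicialMonoid V)

/-- The map `E(a) ⟶ E(b)` induced by a pointed map `{0, …, b} → {0, …, a}`. -/
def pull {a b : ℕ} (f : FinPtd.mk b ⟶ FinPtd.mk a) : E.comp a ⟶ E.comp b :=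
  (E.map f.op).hom

theorem pull_comp {a b c : ℕ} (f : FinPtd.mk c ⟶ FinPtd.mk b) (g : FinPtd.mk b ⟶ FinPtd.mk a) :
    E.pull (f ≫ g) = E.pull g ≫ E.pull f := by
  change (E.map (g.op ≫ f.op)).hom = _
  rw [E.map_comp]
  rfl

theorem act_eq_pull (n : ℕ) (s : Equiv.Perm (Fin n)) : E.act n s = E.pull (ofPerm s⁻¹) := rfl

theorem δ_eq_pull {n : ℕ} (i : Fin (n + 2)) : E.cosimplicialObj.δ i = E.pull (face i) := rfl

/-- The transposition added at each step carries the dropped point from `j` to `j + 1`, keeping the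
others in order. -/
theorem hat_eq_pull (n : ℕ) (i : Fin (n + 1)) : E.hat n i = E.pull (drop i) := by
  induction i using Fin.induction with
  | zero =>
    rw [← face_zero]
    rfl
  | succ j ih =>
    have h : E.hat n j.succ = E.hat n j.castSucc ≫ E.actSwap n j := rfl
    rw [h, ih, actSwap, act_eq_pull, ← pull_comp]
    congr 1
    rw [ofPerm_comp_drop j.succ j.castSucc _ 1 (by simp) ?_, ofPerm_one, Category.comp_id]
    intro l
    apply Fin.ext
    have h1 : ((Equiv.swap j.castSucc j.succ)⁻¹ (j.succ.succAbove l) : ℕ) =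
        if (j.succ.succAbove l : ℕ) = j then (j : ℕ) + 1 else
          if (j.succ.succAbove l : ℕ) = j + 1 then (j : ℕ) else j.succ.succAbove l := by
      rw [Equiv.swap_inv, Equiv.swap_apply_def]
      simp only [Fin.ext_iff, Fin.val_castSucc, Fin.val_succ]
      split_ifs <;> simp
    rw [h1]
    simp only [val_succAbove, Fin.val_castSucc, Fin.val_succ, Equiv.Perm.one_apply]
    split_ifs <;> omega

end Pull

section Abelian

variable {V : Type u} [Category.{v} V] [Abelian V] [MonoidalCategory V]
  (E : SymmCosimplicialMonoid V)

/-- The differential `∑ (-1)^i ∂ᵢ`. -/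
noncomputable def diff (n : ℕ) : E.comp n ⟶ E.comp (n + 1) :=
  ∑ i : Fin (n + 2), (-1 : ℤ) ^ (i : ℕ) • E.pull (face i)

theorem complex_d (n : ℕ) : E.complex.d n (n + 1) = E.diff n :=
  CochainComplex.of_d (fun n => E.comp n) E.diff n

/-- A generalized element of `E(n)` is anti-symmetric. -/
def IsAntisymmetric {n : ℕ} {T : V} (x : T ⟶ E.comp n) : Prop :=
  ∀ s : Equiv.Perm (Fin n), x ≫ E.pull (ofPerm s) = (Equiv.Perm.sign s : ℤ) • x

/-- A generalized element of `E(n)` is poly-primitive. -/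
def IsPolyPrimitive {n : ℕ} {T : V} (x : T ⟶ E.comp n) : Prop :=
  ∀ i : Fin n, x ≫ E.pull (merge i) = x ≫ E.pull (drop i.castSucc) + x ≫ E.pull (drop i.succ)

/-- `act` uses inverses and `IsAntisymmetric` does not; this is harmless because a permutation and
its inverse have the same sign. -/
theorem antisymmetric_factors_iff {n : ℕ} {T : V} (x : T ⟶ E.comp n) :
    (E.antisymmetric n).Factors x ↔ E.IsAntisymmetric x := by
  simp only [antisymmetric, Subobject.finset_inf_factors, Finset.mem_univ, true_imp_iff,
    kernelSubobject_factors_iff, Preadditive.comp_sub, sub_eq_zero, IsAntisymmetric, act_eq_pull,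
    Preadditive.comp_zsmul, Category.comp_id]
  constructor
  · intro h s
    simpa using h s⁻¹
  · intro h s
    simpa using h s⁻¹

theorem polyPrimitive_factors_iff {n : ℕ} {T : V} (x : T ⟶ E.comp n) :
    (E.polyPrimitive n).Factors x ↔ E.IsPolyPrimitive x := by
  simp only [polyPrimitive, Subobject.finset_inf_factors, Finset.mem_univ, true_imp_iff,
    kernelSubobject_factors_iff, Preadditive.comp_sub, sub_eq_zero, IsPolyPrimitive, δ_eq_pull,
    hat_eq_pull, Preadditive.comp_add, face_interior]

theorem P_factors_iff {n : ℕ} {T : V} (x : T ⟶ E.comp n) :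
    (E.P n).Factors x ↔ E.IsAntisymmetric x ∧ E.IsPolyPrimitive x := by
  rw [P, Subobject.inf_factors, antisymmetric_factors_iff, polyPrimitive_factors_iff]

theorem P_arrow (n : ℕ) :
    E.IsAntisymmetric (E.P n).arrow ∧ E.IsPolyPrimitive (E.P n).arrow :=
  (E.P_factors_iff _).1 ((E.P n).factors_self)

variable {E} in
-- Replacing each inner coface by a sum of two neighbouring `drop` terms makes the alternating sum
-- telescope to the two outer cofaces.
theorem IsPolyPrimitive.comp_diff {n : ℕ} {T : V} {x : T ⟶ E.comp n} (hx : E.IsPolyPrimitive x) :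
    x ≫ E.diff n = 0 := by
  have h := sum_face (n := n) (fun f => x ≫ E.pull f)
  rw [diff, Preadditive.comp_sum]
  simp only [Preadditive.comp_zsmul]
  rw [h]
  -- Partial sums up to `m`, so that the telescoping is an induction with `n` fixed.
  have hsum : ∀ m : ℕ, ∀ hm : m ≤ n, ∑ i : Fin m, (-1 : ℤ) ^ (i : ℕ) •
      (x ≫ E.pull (merge (i.castLE hm))) = x ≫ E.pull (drop 0) -
        (-1 : ℤ) ^ m • (x ≫ E.pull (drop ⟨m, by omega⟩)) := by
    intro m
    induction m with
    | zero => intro _; simp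
    | succ m ih =>
      intro hm
      rw [Fin.sum_univ_castSucc]
      have h1 := ih (by omega)
      have h2 := hx ⟨m, hm⟩
      simp only [Fin.castSucc_mk, Fin.succ_mk] at h2
      simp only [Fin.castLE_castSucc, Fin.val_castSucc, Fin.val_last]
      rw [h1]
      change _ + _ • (x ≫ E.pull (merge (⟨m, hm⟩ : Fin n))) = _
      rw [h2, smul_add, pow_succ]
      simp only [mul_neg, _root_.mul_one, neg_smul, sub_neg_eq_add]
      abel
  have h1 := hsum n le_rfl
  simp only [Fin.castLE_rfl, id_eq] at h1
  rw [h1]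
  change _ - _ - (-1 : ℤ) ^ n • (x ≫ E.pull (drop ⟨n, _⟩)) = 0
  simp

/-- The sum `∑ₛ sgn(s) s`. -/
noncomputable def altSum (n : ℕ) : E.comp n ⟶ E.comp n :=
  ∑ s : Equiv.Perm (Fin n), (Equiv.Perm.sign s : ℤ) • E.pull (ofPerm s)

theorem pull_comp_altSum {n : ℕ} (s : Equiv.Perm (Fin n)) :
    E.pull (ofPerm s) ≫ E.altSum n = (Equiv.Perm.sign s : ℤ) • E.altSum n := by
  rw [altSum, Preadditive.comp_sum, Finset.smul_sum]
  refine Fintype.sum_equiv (Equiv.mulLeft s) _ _ fun t => ?_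
  rw [Preadditive.comp_zsmul, ← pull_comp, ofPerm_comp, smul_smul, Equiv.coe_mulLeft,
    Equiv.Perm.sign_mul]
  push_cast
  rw [← _root_.mul_assoc, Int.units_coe_mul_self, _root_.one_mul]

theorem isAntisymmetric_comp_altSum {n : ℕ} {T : V} (x : T ⟶ E.comp n) :
    E.IsAntisymmetric (x ≫ E.altSum n) := by
  intro s
  rw [Category.assoc, ← Preadditive.comp_zsmul]
  congr 1
  rw [altSum, Preadditive.sum_comp, Finset.smul_sum]
  refine Fintype.sum_equiv (Equiv.mulRight s) _ _ fun t => ?_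
  rw [Preadditive.zsmul_comp, ← pull_comp, ofPerm_comp, smul_smul, Equiv.coe_mulRight,
    Equiv.Perm.sign_mul]
  push_cast
  rw [mul_comm (Equiv.Perm.sign t : ℤ), ← _root_.mul_assoc, Int.units_coe_mul_self, _root_.one_mul]

variable {E} in
theorem IsAntisymmetric.comp_altSum {n : ℕ} {T : V} {x : T ⟶ E.comp n}
    (hx : E.IsAntisymmetric x) : x ≫ E.altSum n = n.factorial • x := by
  rw [altSum, Preadditive.comp_sum, Finset.sum_congr rfl (g := fun _ => x)]
  · simp [Finset.card_univ, Fintype.card_perm]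
  · intro s _
    rw [Preadditive.comp_zsmul, hx s, smul_smul, Int.units_coe_mul_self, one_smul]

theorem diff_comp_altSum (n : ℕ) : E.diff n ≫ E.altSum (n + 1) = 0 := by
  rw [← sum_signedSum_face (n := n) (fun f => E.pull f), diff, Preadditive.sum_comp]
  refine Finset.sum_congr rfl fun i _ => ?_
  rw [Preadditive.zsmul_comp, altSum, signedSum, Preadditive.comp_sum]
  simp [pull_comp]

/-- The identity `sum_signedSum_lt_face` is evaluated on a cocycle: its left side vanishes, and its
right side is, up to sign, the defect of additivity at `p`. -/
theorem isPolyPrimitive_comp_altSum {n : ℕ} {T : V} (x : T ⟶ E.comp n)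
    (hx : x ≫ E.diff n = 0) : E.IsPolyPrimitive (x ≫ E.altSum n) := by
  intro p
  have h := sum_signedSum_lt_face (fun f => x ≫ E.pull f) p
  -- For each fixed `s` the sum over faces is the differential of `x` followed by a permutation, so
  -- every weight gives zero.
  have h0 : ∀ c, ∑ i : Fin (n + 2), (-1 : ℤ) ^ (i : ℕ) •
      signedSum (fun f => x ≫ E.pull f) c (face i) = 0 := by
    intro c
    simp only [signedSum, Finset.smul_sum]
    rw [Finset.sum_comm]
    refine Finset.sum_eq_zero fun s _ => ?_
    have h1 : (x ≫ E.diff n) ≫ E.pull (ofPerm s) = 0 := by rw [hx, zero_comp]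
    rw [diff] at h1
    simp only [Category.assoc, Preadditive.sum_comp, Preadditive.comp_sum, Preadditive.zsmul_comp,
      Preadditive.comp_zsmul, ← pull_comp] at h1
    simp only [smul_comm _ (c s * (Equiv.Perm.sign s : ℤ)), ← Finset.smul_sum, h1, smul_zero]
  rw [h0] at h
  have h2 : ∑ t : Equiv.Perm (Fin n), (Equiv.Perm.sign t : ℤ) •
        (x ≫ E.pull (drop p.castSucc ≫ ofPerm t) + x ≫ E.pull (drop p.succ ≫ ofPerm t) -
          x ≫ E.pull (merge p ≫ ofPerm t)) = 0 := by
    have := congrArg (fun y => (-1 : ℤ) ^ (p : ℕ) • y) h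
    simpa [smul_smul, ← mul_pow] using this.symm
  simp only [smul_sub, smul_add, Finset.sum_sub_distrib, Finset.sum_add_distrib] at h2
  rw [eq_comm, ← sub_eq_zero, ← h2]
  simp [altSum, Preadditive.sum_comp, Preadditive.comp_sum, pull_comp]

/-! ### The top Eulerian idempotent -/

variable (𝕜 : Type*) [Field 𝕜] [Linear 𝕜 V]

/-- A product of `n` monic linear factors has leading coefficient one, so the descents do not matter
in top degree. -/
theorem coeff_eulerianPoly (n d : ℕ) : (eulerianPoly 𝕜 n d).coeff n = (n.factorial : 𝕜)⁻¹ := by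
  have hm : (∏ j ∈ Finset.range n,
      (Polynomial.X + Polynomial.C ((j : 𝕜) - (d : 𝕜)))).Monic :=
    Polynomial.monic_prod_of_monic _ _ fun j _ => Polynomial.monic_X_add_C _
  have hd : (∏ j ∈ Finset.range n,
      (Polynomial.X + Polynomial.C ((j : 𝕜) - (d : 𝕜)))).natDegree = n := by
    rw [Polynomial.natDegree_prod_of_monic _ _ fun j _ => Polynomial.monic_X_add_C _]
    simp only [Polynomial.natDegree_X_add_C]
    simp
  have h := hm.coeff_natDegree
  rw [hd] at h
  rw [eulerianPoly, Polynomial.coeff_C_mul, h, _root_.mul_one]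

theorem eulerian_self (n : ℕ) : E.eulerian 𝕜 n n = (n.factorial : 𝕜)⁻¹ • E.altSum n := by
  rw [eulerian, altSum, Finset.smul_sum]
  refine Finset.sum_congr rfl fun s _ => ?_
  rw [coeff_eulerianPoly, act_eq_pull, inv_inv, mul_comm, mul_smul, Int.cast_smul_eq_zsmul]



theorem pull_comp_eulerian {n : ℕ} (s : Equiv.Perm (Fin n)) :
    E.pull (ofPerm s) ≫ E.eulerian 𝕜 n n = (Equiv.Perm.sign s : ℤ) • E.eulerian 𝕜 n n := by
  rw [eulerian_self, Linear.comp_smul, pull_comp_altSum, smul_comm]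

variable {E} in
theorem IsAntisymmetric.comp_eulerian [CharZero 𝕜] {n : ℕ} {T : V} {x : T ⟶ E.comp n}
    (hx : E.IsAntisymmetric x) : x ≫ E.eulerian 𝕜 n n = x := by
  have h : (n.factorial : 𝕜) ≠ 0 := by exact_mod_cast n.factorial_ne_zero
  rw [eulerian_self, Linear.comp_smul, hx.comp_altSum, ← Nat.cast_smul_eq_nsmul 𝕜, smul_smul,
    inv_mul_cancel₀ h, one_smul]

variable {E} in
theorem IsAntisymmetric.smul {n : ℕ} {T : V} {x : T ⟶ E.comp n}
    (hx : E.IsAntisymmetric x) (c : 𝕜) : E.IsAntisymmetric (c • x) := fun s => by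
  rw [Linear.smul_comp, hx s, smul_comm]

variable {E} in
theorem IsPolyPrimitive.smul {n : ℕ} {T : V} {x : T ⟶ E.comp n}
    (hx : E.IsPolyPrimitive x) (c : 𝕜) : E.IsPolyPrimitive (c • x) := fun i => by
  simp only [Linear.smul_comp, hx i, smul_add]

theorem P_factors_comp_eulerian {n : ℕ} {T : V} (x : T ⟶ E.comp n)
    (hx : x ≫ E.diff n = 0) : (E.P n).Factors (x ≫ E.eulerian 𝕜 n n) := by
  rw [P_factors_iff, eulerian_self, Linear.comp_smul]
  exact ⟨(E.isAntisymmetric_comp_altSum x).smul 𝕜 _,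
    (E.isPolyPrimitive_comp_altSum x hx).smul 𝕜 _⟩

end Abelian

/-! ### The top Hodge component -/

section Hodge

variable {V : Type u} [Category.{v} V] [Abelian V] [MonoidalCategory V]
  (E : SymmCosimplicialMonoid V) (𝕜 : Type*) [Field 𝕜] [Linear 𝕜 V]

theorem P_arrow_comp_d (n : ℕ) : (E.P n).arrow ≫ E.complex.d n (n + 1) = 0 :=
  (congrArg (fun f => (E.P n).arrow ≫ f) (E.complex_d n)).trans (E.P_arrow n).2.comp_diff

theorem P_factors_iCycles_comp_eulerian (n : ℕ) {T : V} (x : T ⟶ E.complex.cycles n) :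
    (E.P n).Factors (x ≫ E.complex.iCycles n ≫ E.eulerian 𝕜 n n) := by
  have h : (x ≫ E.complex.iCycles n) ≫ E.complex.d n (n + 1) = 0 := by simp
  have h' := E.P_factors_comp_eulerian 𝕜 (x ≫ E.complex.iCycles n)
    ((congrArg (fun f => (x ≫ E.complex.iCycles n) ≫ f) (E.complex_d n)).symm.trans h)
  exact (Category.assoc x (E.complex.iCycles n) (E.eulerian 𝕜 n n)) ▸ h'

/-- The map from cocycles to `Pⁿ(E)` given by anti-symmetrization. -/
noncomputable def cyclesToP (n : ℕ) : E.complex.cycles n ⟶ (E.P n : V) :=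
  (E.P n).factorThru (E.complex.iCycles n ≫ E.eulerian 𝕜 n n) (by
    simpa using E.P_factors_iCycles_comp_eulerian 𝕜 n (𝟙 _))

theorem cyclesToP_arrow (n : ℕ) :
    E.cyclesToP 𝕜 n ≫ (E.P n).arrow = E.complex.iCycles n ≫ E.eulerian 𝕜 n n :=
  Subobject.factorThru_arrow _ _ _

theorem d_comp_eulerian (i n : ℕ) : E.complex.d i n ≫ E.eulerian 𝕜 n n = 0 := by
  by_cases h : i + 1 = n
  · subst h
    refine (congrArg (fun f => f ≫ E.eulerian 𝕜 (i + 1) (i + 1)) (E.complex_d i)).trans ?_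
    change E.diff i ≫ E.eulerian 𝕜 (i + 1) (i + 1) = 0
    rw [eulerian_self, Linear.comp_smul, diff_comp_altSum, smul_zero]
  -- Differentials between non-consecutive degrees are zero; this includes the incoming one for `n =
  -- 0`.
  · have h0 : E.complex.d i n = 0 := E.complex.shape _ _ (by simpa using h)
    exact (congrArg (fun f => f ≫ E.eulerian 𝕜 n n) h0).trans zero_comp

theorem toCycles_comp_cyclesToP (i n : ℕ) :
    E.complex.toCycles i n ≫ E.cyclesToP 𝕜 n = 0 := by
  rw [← cancel_mono (E.P n).arrow, Category.assoc, cyclesToP_arrow, zero_comp]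
  have h := E.complex.toCycles_i i n
  exact (Category.assoc _ _ _).symm.trans
    ((congrArg (fun f => f ≫ E.eulerian 𝕜 n n) h).trans (E.d_comp_eulerian 𝕜 i n))

/-- The projection of cohomology onto the top Hodge component. -/
noncomputable def homologyToP (n : ℕ) : E.complex.homology n ⟶ (E.P n : V) :=
  (E.complex.homologyIsCokernel _ n rfl).desc
    (CokernelCofork.ofπ (E.cyclesToP 𝕜 n) (E.toCycles_comp_cyclesToP 𝕜 _ n))

theorem homologyπ_comp_homologyToP (n : ℕ) :
    E.complex.homologyπ n ≫ E.homologyToP 𝕜 n = E.cyclesToP 𝕜 n :=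
  (E.complex.homologyIsCokernel _ n rfl).fac _ WalkingParallelPair.one

/-- The inclusion of `Pⁿ(E)` into the cocycles. -/
noncomputable def PToCycles (n : ℕ) : (E.P n : V) ⟶ E.complex.cycles n :=
  E.complex.liftCycles (i := n) (E.P n).arrow (n + 1) (by simp) (E.P_arrow_comp_d n)

theorem PToCycles_iCycles (n : ℕ) :
    E.PToCycles n ≫ E.complex.iCycles n = (E.P n).arrow :=
  E.complex.liftCycles_i _ _ _ _

theorem classMap_P (n : ℕ) :
    E.classMap (E.P n) (E.P_arrow_comp_d n) = E.PToCycles n ≫ E.complex.homologyπ n := rfl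

/-- On anti-symmetric elements `altSum` is multiplication by `n!`, which characteristic zero allows
the idempotent to divide out. -/
theorem PToCycles_comp_cyclesToP [CharZero 𝕜] (n : ℕ) : E.PToCycles n ≫ E.cyclesToP 𝕜 n = 𝟙 _ := by
  rw [← cancel_mono (E.P n).arrow, Category.assoc, cyclesToP_arrow, Category.id_comp]
  exact (Category.assoc _ _ _).symm.trans
    ((congrArg (fun f => f ≫ E.eulerian 𝕜 n n) (E.PToCycles_iCycles n)).trans
      ((E.P_arrow n).1.comp_eulerian 𝕜))

theorem classMap_comp_homologyToP [CharZero 𝕜] (n : ℕ) :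
    E.classMap (E.P n) (E.P_arrow_comp_d n) ≫ E.homologyToP 𝕜 n = 𝟙 _ := by
  rw [classMap_P, Category.assoc, homologyπ_comp_homologyToP, PToCycles_comp_cyclesToP]

theorem isAntisymmetric_of_eulerianImage_factors {n : ℕ} {T : V} {x : T ⟶ E.comp n}
    (hx : (E.eulerianImage 𝕜 n n).Factors x) : E.IsAntisymmetric x := by
  have h : eulerianImage E 𝕜 n n ≤ E.antisymmetric n := by
    have h1 : (E.antisymmetric n).Factors (E.eulerian 𝕜 n n) := by
      rw [antisymmetric_factors_iff, eulerian_self]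
      have := (E.isAntisymmetric_comp_altSum (𝟙 (E.comp n))).smul 𝕜 ((n.factorial : 𝕜)⁻¹)
      simpa using this
    exact imageSubobject_le _ ((E.antisymmetric n).factorThru _ h1)
      (Subobject.factorThru_arrow _ _ _)
  exact (E.antisymmetric_factors_iff x).1 (Subobject.factors_of_le x h hx)

theorem eulerianImage_factors_of_isAntisymmetric [CharZero 𝕜] {n : ℕ} {T : V} {x : T ⟶ E.comp n}
    (hx : E.IsAntisymmetric x) : (E.eulerianImage 𝕜 n n).Factors x := by
  have h := imageSubobject_factors_comp_self (f := E.eulerian 𝕜 n n) x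
  rwa [hx.comp_eulerian 𝕜] at h

/-- An element of `P n` is a cocycle fixed by the idempotent, hence in its image. Conversely, a
cocycle in that image is fixed by it, hence equal to its own anti-symmetrization, which lies in `P
n`. -/
theorem imageSubobject_classMap_P [CharZero 𝕜] (n : ℕ) :
    imageSubobject (E.classMap (E.P n) (E.P_arrow_comp_d n)) = E.hodgeComponent 𝕜 n n := by
  let S := (Subobject.pullback (E.complex.iCycles n)).obj (eulerianImage E 𝕜 n n)
  have hpb := Subobject.isPullback (E.complex.iCycles n) (eulerianImage E 𝕜 n n)
  have hH : E.hodgeComponent 𝕜 n n =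
    imageSubobject (S.arrow ≫ E.complex.homologyπ n) := rfl
  rw [hH]
  apply le_antisymm
  · have hf := E.eulerianImage_factors_of_isAntisymmetric 𝕜 (E.P_arrow n).1
    let l : (E.P n : V) ⟶ (S : V) := hpb.lift ((eulerianImage E 𝕜 n n).factorThru _ hf)
      (E.PToCycles n) ((Subobject.factorThru_arrow _ _ _).trans (E.PToCycles_iCycles n).symm)
    have hl : l ≫ S.arrow = E.PToCycles n := hpb.lift_snd _ _ _
    refine imageSubobject_le _ (l ≫ factorThruImageSubobject _) ?_
    rw [Category.assoc, imageSubobject_arrow_comp, classMap_P, ← hl,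
      Category.assoc]
  · have hS : (S.arrow ≫ E.complex.iCycles n) ≫ E.eulerian 𝕜 n n =
        S.arrow ≫ E.complex.iCycles n := by
      refine IsAntisymmetric.comp_eulerian (E := E) (x := S.arrow ≫ E.complex.iCycles n) 𝕜
        (E.isAntisymmetric_of_eulerianImage_factors 𝕜 ?_)
      exact (Subobject.factors_iff _ _).2 ⟨_, hpb.w⟩
    have h : (S.arrow ≫ E.cyclesToP 𝕜 n) ≫ E.PToCycles n = S.arrow := by
      rw [← cancel_mono (E.complex.iCycles n), Category.assoc, PToCycles_iCycles]
      exact (Category.assoc _ _ _).trans ((congrArg (fun f => S.arrow ≫ f)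
        (E.cyclesToP_arrow 𝕜 n)).trans ((Category.assoc _ _ _).symm.trans hS))
    refine imageSubobject_le _ ((S.arrow ≫ E.cyclesToP 𝕜 n) ≫ factorThruImageSubobject _) ?_
    rw [Category.assoc, imageSubobject_arrow_comp, classMap_P, ← Category.assoc, h]

end Hodge

end SymmCosimplicialMonoid

/-! ### Vanishing of products of poly-primitive elements -/

namespace FinPtd

/-- The pointed map which agrees with `g` outside of `S` and sends `S` to the base point. -/
def cut {r p : ℕ} (g : FinPtd.mk r ⟶ FinPtd.mk p) (S : Finset (Fin r)) :
    FinPtd.mk r ⟶ FinPtd.mk p :=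
  ofFun fun v => if v ∈ S then 0 else g.1 v.succ

@[simp] theorem cut_succ {r p : ℕ} (g : FinPtd.mk r ⟶ FinPtd.mk p) (S : Finset (Fin r))
    (v : Fin r) : (cut g S).1 v.succ = if v ∈ S then 0 else g.1 v.succ := rfl

/-- The points which are not sent to the base point. -/
def support {r p : ℕ} (g : FinPtd.mk r ⟶ FinPtd.mk p) : Finset (Fin r) :=
  Finset.univ.filter fun v => g.1 v.succ ≠ 0

@[simp] theorem mem_support {r p : ℕ} (g : FinPtd.mk r ⟶ FinPtd.mk p) (v : Fin r) :
    v ∈ support g ↔ g.1 v.succ ≠ 0 := by simp [support]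

/-- The decreasing measure for the induction in `IsPolyPrimitive.comp_pull_mem`. -/
theorem card_support_cut_lt {r p : ℕ} (g : FinPtd.mk r ⟶ FinPtd.mk p) (S : Finset (Fin r))
    (v : Fin r) (hv : v ∈ S) (hg : g.1 v.succ ≠ 0) :
    (support (cut g S)).card < (support g).card := by
  apply Finset.card_lt_card
  rw [Finset.ssubset_iff_of_subset]
  · exact ⟨v, by simpa using hg, by simp [hv]⟩
  · intro w hw
    by_cases h : w ∈ S <;> simp_all

/-- The map `g` is inverse to `s` on the image of `s`, and trivial elsewhere. -/
def IsSection {r p : ℕ} (g : FinPtd.mk r ⟶ FinPtd.mk p) (s : Fin p → Fin r) : Prop :=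
  ∀ v j, g.1 v.succ = j.succ ↔ v = s j

theorem IsSection.injective {r p : ℕ} {g : FinPtd.mk r ⟶ FinPtd.mk p} {s : Fin p → Fin r}
    (h : IsSection g s) : Function.Injective s := fun i j e => by
  have h1 := (h (s i) i).2 rfl
  have h2 := (h (s i) j).2 e
  exact Fin.succ_injective _ (h1.symm.trans h2)

theorem IsSection.ofPerm_swap_comp {r p : ℕ} {g : FinPtd.mk r ⟶ FinPtd.mk p} {s : Fin p → Fin r}
    (h : IsSection g s) (i j : Fin p) :
    ofPerm (Equiv.swap (s i) (s j)) ≫ g = g ≫ ofPerm (Equiv.swap i j) := by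
  refine hom_ext fun v => fin_ext fun l => ?_
  have h1 : (g ≫ ofPerm (Equiv.swap i j)).1 v.succ = l.succ ↔
      g.1 v.succ = (Equiv.swap i j l).succ := by
    rw [comp_apply]
    rcases Fin.eq_zero_or_eq_succ (g.1 v.succ) with h0 | ⟨m, h0⟩
    · rw [h0, map_zero]
      constructor <;> intro h' <;> exact absurd h'.symm (Fin.succ_ne_zero _)
    · rw [h0, ofPerm_succ, Fin.succ_inj, Fin.succ_inj, Equiv.swap_apply_eq_iff]
  rw [h1, comp_apply, ofPerm_succ, h, h, Equiv.swap_apply_eq_iff, h.injective.map_swap]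

/-- The pointed map which corresponds to a nondecreasing map. -/
def gammaMap {a b : ℕ} (t : ⦋a⦌ ⟶ ⦋b⦌) : FinPtd.mk b ⟶ FinPtd.mk a :=
  (simplexToGamma.map t).unop

end FinPtd

namespace SymmCosimplicialMonoid

open FinPtd

/-! ### Additivity of poly-primitive elements along fibres -/

section Additivity

variable {V : Type u} [Category.{v} V] [Abelian V] [MonoidalCategory V]
  {E : SymmCosimplicialMonoid V}

/-- `S` and `S'` partition the fibre over `i`. Doubling the point `i` lifts `g` along `merge i`,
with `S` over the first copy and `S'` over the second; poly-primitivity then splits the result into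
the two ways of dropping a copy. -/
theorem IsPolyPrimitive.comp_pull_eq_add {p r : ℕ} {T : V} {x : T ⟶ E.comp p}
    (hx : E.IsPolyPrimitive x) (g : FinPtd.mk r ⟶ FinPtd.mk p) (i : Fin p) (S S' : Finset (Fin r))
    (hS : ∀ v ∈ S, g.1 v.succ = i.succ) (hS' : ∀ v ∈ S', g.1 v.succ = i.succ)
    (h : ∀ v, g.1 v.succ = i.succ → (v ∈ S ↔ v ∉ S')) :
    x ≫ E.pull g = x ≫ E.pull (cut g S) + x ≫ E.pull (cut g S') := by
  let k : FinPtd.mk r ⟶ FinPtd.mk (p + 1) := ofFun fun v =>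
    if v ∈ S then i.castSucc.succ else if v ∈ S' then i.succ.succ else
      Fin.cases (motive := fun _ => Fin (p + 2)) 0
        (fun j => (i.castSucc.succAbove j).succ) (g.1 v.succ)
  have hk : ∀ v, k.1 v.succ = if v ∈ S then i.castSucc.succ else if v ∈ S' then i.succ.succ else
      Fin.cases (motive := fun _ => Fin (p + 2)) 0
        (fun j => (i.castSucc.succAbove j).succ) (g.1 v.succ) := fun v => rfl
  have hcases : ∀ v, (v ∈ S ∧ v ∉ S' ∧ g.1 v.succ = i.succ ∧ k.1 v.succ = i.castSucc.succ) ∨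
      (v ∉ S ∧ v ∈ S' ∧ g.1 v.succ = i.succ ∧ k.1 v.succ = i.succ.succ) ∨
      (v ∉ S ∧ v ∉ S' ∧ g.1 v.succ = 0 ∧ k.1 v.succ = 0) ∨
      (v ∉ S ∧ v ∉ S' ∧ ∃ j, j ≠ i ∧ g.1 v.succ = j.succ ∧
        k.1 v.succ = (i.castSucc.succAbove j).succ) := by
    intro v
    by_cases h1 : v ∈ S
    · exact Or.inl ⟨h1, (h v (hS v h1)).1 h1, hS v h1, by rw [hk, if_pos h1]⟩
    · by_cases h2 : v ∈ S'
      · exact Or.inr (Or.inl ⟨h1, h2, hS' v h2, by rw [hk, if_neg h1, if_pos h2]⟩)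
      · rcases Fin.eq_zero_or_eq_succ (g.1 v.succ) with h0 | ⟨j, h0⟩
        · exact Or.inr (Or.inr (Or.inl ⟨h1, h2, h0, by
            rw [hk, if_neg h1, if_neg h2, h0]; rfl⟩))
        · refine Or.inr (Or.inr (Or.inr ⟨h1, h2, j, ?_, h0, by
            rw [hk, if_neg h1, if_neg h2, h0]; rfl⟩))
          rintro rfl
          exact h1 ((h v h0).2 h2)
  have hne : ∀ j, j ≠ i → i.castSucc.succAbove j = i.succ.succAbove j := by
    intro j hj
    have hj' : (j : ℕ) ≠ i := fun e => hj (Fin.ext e)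
    apply Fin.ext
    rw [val_succAbove, val_succAbove]
    simp only [Fin.val_castSucc, Fin.val_succ]
    split_ifs <;> omega
  have hcs : i.succ.succAbove i = i.castSucc := Fin.succAbove_succ_self i
  have hsc : i.castSucc.succAbove i = i.succ := Fin.succAbove_castSucc_self i
  have e1 : k ≫ merge i = g := by
    refine hom_ext fun v => ?_
    rw [FinPtd.comp_apply]
    rcases hcases v with ⟨_, _, h3, h4⟩ | ⟨_, _, h3, h4⟩ | ⟨_, _, h3, h4⟩ | ⟨_, _, j, _, h3, h4⟩ <;>
      rw [h3, h4]
    · simp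
    · simp
    · simp
    · simp
  have e2 : k ≫ drop i.castSucc = cut g S := by
    refine hom_ext fun v => ?_
    rw [FinPtd.comp_apply, cut_succ]
    rcases hcases v with ⟨h1, _, h3, h4⟩ | ⟨h1, _, h3, h4⟩ | ⟨h1, _, h3, h4⟩ |
      ⟨h1, _, j, _, h3, h4⟩ <;> rw [h3, h4] <;> simp only [h1, if_true, if_false]
    · exact drop_same _
    · exact (congrArg (fun a => (drop i.castSucc).1 (Fin.succ a)) hsc.symm).trans
        (drop_succAbove _ _)
    · exact (drop _).2
    · exact drop_succAbove _ _
  have e3 : k ≫ drop i.succ = cut g S' := by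
    refine hom_ext fun v => ?_
    rw [FinPtd.comp_apply, cut_succ]
    rcases hcases v with ⟨_, h1, h3, h4⟩ | ⟨_, h1, h3, h4⟩ | ⟨_, h1, h3, h4⟩ |
      ⟨_, h1, j, hj, h3, h4⟩ <;> rw [h3, h4] <;> simp only [h1, if_true, if_false]
    · exact (congrArg (fun a => (drop i.succ).1 (Fin.succ a)) hcs.symm).trans
        (drop_succAbove _ _)
    · exact drop_same _
    · exact (drop _).2
    · rw [hne j hj]; exact drop_succAbove _ _
  rw [← e2, ← e3, ← e1, pull_comp, pull_comp, pull_comp, ← Category.assoc, hx i,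
    Preadditive.add_comp, Category.assoc, Category.assoc]

/-- Fibres are split until they are singletons. A submonoid `K` replaces an explicit decomposition
into sections, since only closure under sums is used. -/
theorem IsPolyPrimitive.comp_pull_mem {p r : ℕ} {T : V} {x : T ⟶ E.comp p}
    (hx : E.IsPolyPrimitive x) (K : AddSubmonoid (T ⟶ E.comp r))
    (hK : ∀ (g : FinPtd.mk r ⟶ FinPtd.mk p) (s : Fin p → Fin r), IsSection g s →
      x ≫ E.pull g ∈ K) (g : FinPtd.mk r ⟶ FinPtd.mk p) : x ≫ E.pull g ∈ K := by
  induction hN : (support g).card using Nat.strong_induction_on generalizing g with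
  | _ N ih =>
    subst hN
    by_cases h0 : ∃ i : Fin p, ∀ v : Fin r, g.1 v.succ ≠ i.succ
    · obtain ⟨i, hi⟩ := h0
      -- An empty fibre has the partition `∅ ∪ ∅`, so the element equals twice itself and vanishes.
      have h1 := hx.comp_pull_eq_add g i ∅ ∅ (by simp) (by simp) (fun v hv => absurd hv (hi v))
      have h2 : cut g ∅ = g := hom_ext fun v => by simp
      rw [h2, left_eq_add] at h1
      rw [h1]
      exact K.zero_mem
    · push Not at h0
      choose s hs using h0
      by_cases h1 : IsSection g s
      · exact hK g s h1
      · obtain ⟨v, j, hv, hvs⟩ : ∃ (v : Fin r) (j : Fin p), g.1 v.succ = j.succ ∧ v ≠ s j := by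
          by_contra hc
          push Not at hc
          exact h1 fun v j => ⟨hc v j, fun e => e ▸ hs j⟩
        -- The fibre over `j` contains `v` and `s j`, which differ; splitting off `v` leaves both
        -- parts nonempty, so each cut shrinks the support.
        let F := Finset.univ.filter fun w : Fin r => g.1 w.succ = j.succ ∧ w ≠ v
        have h2 := hx.comp_pull_eq_add g j {v} F (by simpa using hv) (by simp [F]; tauto)
          (by intro w hw; simp [F, hw])
        rw [h2]
        refine K.add_mem (ih _ (card_support_cut_lt g _ v (by simp) ?_) _ rfl)
          (ih _ (card_support_cut_lt g _ (s j) ?_ ?_) _ rfl)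
        · rw [hv]; exact Fin.succ_ne_zero _
        · simp only [F, Finset.mem_filter, Finset.mem_univ, true_and]
          exact ⟨hs j, hvs.symm⟩
        · rw [hs]; exact Fin.succ_ne_zero _

theorem IsAntisymmetric.comp_pull_swap {p r : ℕ} {T : V} {x : T ⟶ E.comp p}
    (hx : E.IsAntisymmetric x) {g : FinPtd.mk r ⟶ FinPtd.mk p} {s : Fin p → Fin r}
    (h : IsSection g s) {i j : Fin p} (hij : i ≠ j) :
    (x ≫ E.pull g) ≫ E.pull (ofPerm (Equiv.swap (s i) (s j))) = -(x ≫ E.pull g) := by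
  rw [Category.assoc, ← pull_comp, h.ofPerm_swap_comp, pull_comp, ← Category.assoc, hx,
    Equiv.Perm.sign_swap hij]
  simp

end Additivity

/-! ### Products and pointed maps -/

section Product

variable {V : Type u} [Category.{v} V] [MonoidalCategory V]
  (E : SymmCosimplicialMonoid V)

/-- The multiplication of `E(n)`. -/
def mul (n : ℕ) : E.comp n ⊗ E.comp n ⟶ E.comp n := μ[(E.cosimplicial.obj ⦋n⦌).X]

theorem mul_comp_pull {a b : ℕ} (f : FinPtd.mk b ⟶ FinPtd.mk a) :
    E.mul a ≫ E.pull f = (E.pull f ⊗ₘ E.pull f) ≫ E.mul b :=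
  IsMonHom.mul_hom (E.map f.op).hom

end Product

section Cup

variable {V : Type u} [Category.{v} V] [Preadditive V] [MonoidalCategory V]
  (E : SymmCosimplicialMonoid V)

/-- The Steenrod product as a map between the components of `E`. -/
noncomputable def cup (k p q m : ℕ) : E.comp p ⊗ E.comp q ⟶ E.comp m :=
  steenrod E.cosimplicial k p q m

theorem cup_eq_sum (k p q m : ℕ) : ∃ c : LatticePath m p q → ℤ,
    E.cup k p q m = ∑ w, c w • ((E.pull (gammaMap w.dualFst) ⊗ₘ
      E.pull (gammaMap w.dualSnd)) ≫ E.mul m) := by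
  classical
  let c : LatticePath m p q → ℤ := fun w =>
    if w.IsSmooth ∧ w.complexity = k + 1 ∧ w.IsEven then
      (-1) ^ ((p + 1) * (q + 1)) * w.sign else 0
  refine ⟨c, Finset.sum_congr rfl fun w _ => ?_⟩
  by_cases h : w.IsSmooth ∧ w.complexity = k + 1 ∧ w.IsEven
  · have e : c w = _ := if_pos h
    rw [e]
    exact if_pos h
  · have e : c w = 0 := if_neg h
    rw [e, zero_smul]
    exact if_neg h

end Cup

/-! ### Vanishing in the top degree component -/

section Vanishing

variable {V : Type u} [Category.{v} V] [Abelian V] [MonoidalCategory V]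
  [MonoidalPreadditive V] {E : SymmCosimplicialMonoid V}
  (𝕜 : Type*) [Field 𝕜] [CharZero 𝕜] [Linear 𝕜 V]

/-- By inclusion-exclusion the two images meet in at least `p + q - r ≥ 2` points. -/
theorem exists_common_of_sections {p q r : ℕ} {s : Fin p → Fin r} {t : Fin q → Fin r}
    (hs : Function.Injective s) (ht : Function.Injective t) (h : r + 2 ≤ p + q) :
    ∃ i j k l, i ≠ j ∧ k ≠ l ∧ s i = t k ∧ s j = t l := by
  have h1 : 1 < (Finset.univ.image s ∩ Finset.univ.image t).card := by
    have h2 := Finset.card_union_add_card_inter (Finset.univ.image s) (Finset.univ.image t)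
    rw [Finset.card_image_of_injective _ hs, Finset.card_image_of_injective _ ht] at h2
    have h3 := Finset.card_le_univ (Finset.univ.image s ∪ Finset.univ.image t)
    simp only [Finset.card_univ, Fintype.card_fin] at h2 h3
    omega
  obtain ⟨u, hu, v, hv, huv⟩ := Finset.one_lt_card.1 h1
  simp only [Finset.mem_inter, Finset.mem_image, Finset.mem_univ, true_and] at hu hv
  obtain ⟨⟨i, rfl⟩, k, hk⟩ := hu
  obtain ⟨⟨j, rfl⟩, l, hl⟩ := hv
  refine ⟨i, j, k, l, fun e => huv (by rw [e]), fun e => huv (by rw [← hk, ← hl, e]), hk.symm,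
    hl.symm⟩


theorem tensor_pull_comp_mul_comp_eulerian {p q r : ℕ} {T U : V} {x : T ⟶ E.comp p}
    {y : U ⟶ E.comp q} (hx : E.IsAntisymmetric x) (hx' : E.IsPolyPrimitive x)
    (hy : E.IsAntisymmetric y) (hy' : E.IsPolyPrimitive y) (h : r + 2 ≤ p + q)
    (f : FinPtd.mk r ⟶ FinPtd.mk p) (g : FinPtd.mk r ⟶ FinPtd.mk q) :
    ((x ≫ E.pull f) ⊗ₘ (y ≫ E.pull g)) ≫ E.mul r ≫ E.eulerian 𝕜 r r = 0 := by
  -- Vanishing is additive in each factor, so both pointed maps may be reduced to sections, one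
  -- after the other.
  let K (z : U ⟶ E.comp r) : AddSubmonoid (T ⟶ E.comp r) :=
    { carrier := {w | (w ⊗ₘ z) ≫ E.mul r ≫ E.eulerian 𝕜 r r = 0}
      zero_mem' := by simp
      add_mem' := fun {a b} ha hb => by
        simp only [Set.mem_ofPred_eq] at ha hb ⊢
        rw [MonoidalPreadditive.add_tensor, Preadditive.add_comp, ha, hb, add_zero] }
  let L (w : T ⟶ E.comp r) : AddSubmonoid (U ⟶ E.comp r) :=
    { carrier := {z | (w ⊗ₘ z) ≫ E.mul r ≫ E.eulerian 𝕜 r r = 0}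
      zero_mem' := by simp
      add_mem' := fun {a b} ha hb => by
        simp only [Set.mem_ofPred_eq] at ha hb ⊢
        rw [MonoidalPreadditive.tensor_add, Preadditive.add_comp, ha, hb, add_zero] }
  refine hx'.comp_pull_mem (K (y ≫ E.pull g)) (fun f s hs => ?_) f
  refine hy'.comp_pull_mem (L (x ≫ E.pull f)) (fun g t ht => ?_) g
  obtain ⟨i, j, k, l, hij, hkl, hik, hjl⟩ := exists_common_of_sections hs.injective ht.injective h
  have h1 := hx.comp_pull_swap hs hij
  have h2 := hy.comp_pull_swap ht hkl
  rw [← hik, ← hjl] at h2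
  have hne : s i ≠ s j := fun e => hij (hs.injective e)
  change ((x ≫ E.pull f) ⊗ₘ (y ≫ E.pull g)) ≫ E.mul r ≫ E.eulerian 𝕜 r r = 0
  generalize x ≫ E.pull f = a at h1 ⊢
  generalize y ≫ E.pull g = b at h2 ⊢
  -- The transposition acts multiplicatively and negates both factors, so the product is unchanged.
  have h3 : (a ⊗ₘ b) ≫ E.mul r ≫ E.pull (ofPerm (Equiv.swap (s i) (s j))) =
      (a ⊗ₘ b) ≫ E.mul r := by
    rw [mul_comp_pull, ← Category.assoc, MonoidalCategory.tensorHom_comp_tensorHom, h1, h2]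
    have h4 : (-a ⊗ₘ -b) = (a ⊗ₘ b) := by
      have e1 : (-a ⊗ₘ -b) + (a ⊗ₘ -b) = 0 := by
        rw [← MonoidalPreadditive.add_tensor]; simp
      have e2 : (a ⊗ₘ b) + (a ⊗ₘ -b) = 0 := by
        rw [← MonoidalPreadditive.tensor_add]; simp
      exact add_right_cancel (e1.trans e2.symm)
    rw [h4]
  -- The idempotent absorbs the same transposition with sign `-1`; the element is its own negative,
  -- and `2` is invertible.
  have h5 : (a ⊗ₘ b) ≫ E.mul r ≫ E.eulerian 𝕜 r r = -((a ⊗ₘ b) ≫ E.mul r ≫ E.eulerian 𝕜 r r) := by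
    conv_lhs => rw [← Category.assoc, ← h3, Category.assoc, Category.assoc, pull_comp_eulerian,
      Equiv.Perm.sign_swap hne]
    simp
  have h6 : (2 : 𝕜) • ((a ⊗ₘ b) ≫ E.mul r ≫ E.eulerian 𝕜 r r) = 0 := by
    rw [two_smul]
    nth_rewrite 1 [h5]
    exact neg_add_cancel _
  exact (smul_eq_zero.1 h6).resolve_left two_ne_zero

theorem P_tensor_comp_steenrod_comp_eulerian (E : SymmCosimplicialMonoid V) (k : ℕ) {m n r : ℕ}
    (h : r + 2 ≤ m + n) :
    ((E.P m).arrow ⊗ₘ (E.P n).arrow) ≫ E.cup k m n r ≫ E.eulerian 𝕜 r r = 0 := by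
  obtain ⟨c, hc⟩ := E.cup_eq_sum k m n r
  rw [hc, Preadditive.sum_comp, Preadditive.comp_sum]
  refine Finset.sum_eq_zero fun w _ => ?_
  rw [Preadditive.zsmul_comp, Preadditive.comp_zsmul, Category.assoc, ← Category.assoc,
    MonoidalCategory.tensorHom_comp_tensorHom,
    tensor_pull_comp_mul_comp_eulerian 𝕜 (E.P_arrow m).1 (E.P_arrow m).2 (E.P_arrow n).1
      (E.P_arrow n).2 h, smul_zero]

/-- Naturality of the braiding turns the second term into a Steenrod product on `P n ⊗ P m`, covered
by the same vanishing. -/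
theorem P_tensor_comp_bracket_comp_eulerian [BraidedCategory V] (E : SymmCosimplicialMonoid V)
    (k : ℕ) {m n r : ℕ} (h : r + 2 ≤ m + n) :
    ((E.P m).arrow ⊗ₘ (E.P n).arrow) ≫
      (E.cup k m n r - ((-1 : ℤ) ^ (k + m * n)) •
        ((β_ (E.comp m) (E.comp n)).hom ≫ E.cup k n m r)) ≫ E.eulerian 𝕜 r r = 0 := by
  have h2 := P_tensor_comp_steenrod_comp_eulerian 𝕜 E k (m := n) (n := m) (r := r) (by omega)
  have h3 : ((E.P m).arrow ⊗ₘ (E.P n).arrow) ≫ (β_ (E.comp m) (E.comp n)).hom ≫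
      E.cup k n m r ≫ E.eulerian 𝕜 r r = 0 := by
    rw [← Category.assoc, BraidedCategory.braiding_naturality, Category.assoc, h2, comp_zero]
  rw [Preadditive.sub_comp, Preadditive.comp_sub, P_tensor_comp_steenrod_comp_eulerian 𝕜 E k h,
    Preadditive.zsmul_comp, Preadditive.comp_zsmul, Category.assoc, h3, smul_zero, sub_zero]

end Vanishing

end SymmCosimplicialMonoid

theorem mainTheorem10 {𝕜 : Type*} [Field 𝕜] [CharZero 𝕜]
    {V : Type u} [Category.{v} V] [Abelian V] [Linear 𝕜 V] [MonoidalCategory V]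
    [SymmetricCategory V] [MonoidalPreadditive V] [MonoidalLinear 𝕜 V]
    (E : SymmCosimplicialMonoid V) :
    (∀ n : ℕ, ∃ h : (E.P n).arrow ≫ E.complex.d n (n + 1) = 0,
      Mono (E.classMap (E.P n) h) ∧
      imageSubobject (E.classMap (E.P n) h) = E.hodgeComponent 𝕜 n n ∧
      ∃ π : E.complex.homology n ⟶ (E.P n : V),
        E.complex.homologyπ n ≫ π ≫ (E.P n).arrow =
          E.complex.iCycles n ≫ E.eulerian 𝕜 n n ∧
        E.classMap (E.P n) h ≫ π = 𝟙 (E.P n : V)) ∧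
    (∀ k : ℕ, 2 ≤ k → IsNCommutative E.cosimplicial k →
      ∀ m n r : ℕ, r + k = m + n →
        ((E.P m).arrow ⊗ₘ (E.P n).arrow) ≫ bracket E.cosimplicial k m n r ≫
          E.eulerian 𝕜 r r = 0 ∧
        ((E.P m).arrow ⊗ₘ (E.P n).arrow) ≫ steenrod E.cosimplicial k m n r ≫
          E.eulerian 𝕜 r r = 0) := by
  -- With `r + k = m + n`, the bound `2 ≤ k` is exactly what yields `r + 2 ≤ m + n`, hence two
  -- common points.
  refine ⟨fun n => ⟨E.P_arrow_comp_d n, ?_, E.imageSubobject_classMap_P 𝕜 n,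
    E.homologyToP 𝕜 n, ?_, E.classMap_comp_homologyToP 𝕜 n⟩, fun k hk _ m n r hr =>
    ⟨E.P_tensor_comp_bracket_comp_eulerian 𝕜 k (by omega),
      E.P_tensor_comp_steenrod_comp_eulerian 𝕜 k (by omega)⟩⟩
  · have : IsSplitMono (E.classMap (E.P n) (E.P_arrow_comp_d n)) :=
      IsSplitMono.mk' ⟨E.homologyToP 𝕜 n, E.classMap_comp_homologyToP 𝕜 n⟩
    infer_instance
  · rw [← Category.assoc, E.homologyπ_comp_homologyToP]
    exact E.cyclesToP_arrow 𝕜 n
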